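/- Let $q\in\mathbb C$ with $0<|q|<1$. For $x\in\mathbb C$ and $k=0,1,2,\dots$ write $(x)_k=\prod_{j=0}^{k-1}(1-xq^j)$ and $(x_1,\dots,x_m)_k=(x_1)_k\cdots(x_m)_k$. **Theorem (a $C_r$ terminating ${}_{10}\phi_9$ transformation).** Let $r\ge 1$, let $n_1,\dots,n_r$ be nonnegative integers, and let $a,b,c,d,e_i,f_i,g_i$ ($1\le i\le r$) be complex numbers with $a\neq0$ such that $$a^3q^{3-r+n_i}=bcde_if_ig_i\qquad(i=1,\dots,r).$$ Put $\lambda=a^2q^{2-r}/(bcd)$. Assume that no denominator below vanishes, i.e. $a\ne1$, $\lambda\neq1$, $(b\lambda/a,c\lambda/a,d\lambda/a)_{r-1}\ne0$, and, for all $i$, $(aq/b,aq/c,aq/d,aq/e_i,aq/f_i,aq/g_i,aq^{1+n_i})_{n_i}\neq0$ and $(\lambda q/e_i,\lambda q/f_i,\lambda q/g_i,\lambda q^{1+n_i},\lambda q,\lambda q/e_if_i)_{n_i}\ne0$. Then $$\begin{aligned} &\sum_{\substack{0\le k_i\le n_i\\ i=1,\dots,r}}\ \prod_{1\le i<j\le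 r}(q^{k_i}-q^{k_j})(1-aq^{k_i+k_j})\prod_{i=1}^r\frac{(1-aq^{2k_i})\,(a,b,c,d,e_i,f_i,g_i,q^{-n_i})_{k_i}}{(1-a)\,(q,aq/b,aq/c,aq/d,aq/e_i,aq/f_i,aq/g_i,aq^{1+n_i})_{k_i}}\,q^{k_i}\\ &=\left(\frac{\lambda}{a}\right)^{\binom r2}\prod_{i=1}^{r-1}\frac{(b,c,d)_i}{(b\lambda/a,c\lambda/a,d\lambda/a)_i}\prod_{i=1}^r\frac{(aq,\lambda q/e_i,\lambda q/f_i,aq/e_if_i)_{n_i}}{(\lambda q,aq/e_i,aq/f_i,\lambda q/e_if_i)_{n_i}}\\ &\quad\times\sum_{\substack{0\le k_i\le n_i\\ i=1,\dots,r}}\ \prod_{1\le i<j\le r}(q^{k_i}-q^{k_j})(1-\lambda q^{k_i+k_j})\prod_{i=1}^r\frac{(1-\lambda q^{2k_i})\,(\lambda,\lambda b/a,\lambda c/a,\lambda d/a,e_i,f_i,g_i,q^{-n_i})_{k_i}}{(1-\lambda)\,(q,aq/b,aq/c,aq/d,\lambda q/e_i,\lambda q/f_i,\lambda q/g_i,\lambda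 q^{1+n_i})_{k_i}}\,q^{k_i}. \end{aligned}$$ The case $r=1$ is Bailey's terminating ${}_{10}\phi_9$ transformation: if $n\geq0$ is an integer, $a\ne0$, $a^3q^{2+n}=bcdefg$, $\lambda=a^2q/(bcd)$, and $a^{1/2},\lambda^{1/2}$ denote any square roots of $a,\lambda$, then $$\begin{aligned} &{}_{10}\phi_9\!\left[\begin{matrix}a,qa^{\frac12},-qa^{\frac12},b,c,d,e,f,g,q^{-n}\\ a^{\frac12},-a^{\frac12},aq/b,aq/c,aq/d,aq/e,aq/f,aq/g,aq^{1+n}\end{matrix};q,q\right] =\frac{(aq,aq/ef,\lambda q/e,\lambda q/f)_n}{(aq/e,aq/f,\lambda q/ef,\lambda q)_n}\\ &\quad\times{}_{10}\phi_9\!\left[\begin{matrix}\lambda,q\lambda^{\frac12},-q\lambda^{\frac12},\lambda b/a,\lambda c/a,\lambda d/a,e,f,g,q^{-n}\\ \lambda^{\frac12},-\lambda^{\frac12},aq/b,aq/c,aq/d,\lambda q/e,\lambda q/f,\lambda q/g,\lambda q^{1+n}\end{matrix};q,q\right], \end{aligned}$$ provided that $(y)_n\ne0$ for every lower parameter $y$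 of the two series and $(\lambda q/ef,\lambda q)_n\neq0$. Here ${}_{10}\phi_9\bigl[{a_1,\dots,a_{10}\atop b_1,\dots,b_9};q,z\bigr]=\sum_{k\ge0}\frac{(a_1,\dots,a_{10})_k}{(q,b_1,\dots,b_9)_k}z^k$; both series terminate, the terms with $k>n$ being zero because of the upper parameter $q^{-n}$. -/

import Mathlib

/-- The `q`-shifted factorial `(a; q)_k = ∏_{j=0}^{k-1} (1 - a q^j)` for `k = 0, 1, 2, …`. -/
noncomputable def qShiftedFactorial (q a : ℂ) (k : ℕ) : ℂ :=
  ∏ j ∈ Finset.range k, (1 - a * q ^ j)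

/-- The condensed notation `(a₁, …, a_m)_k = (a₁; q)_k ⋯ (a_m; q)_k`. -/
noncomputable def qShiftedFactorials (q : ℂ) (as : List ℂ) (k : ℕ) : ℂ :=
  (as.map fun a => qShiftedFactorial q a k).prod

/-- The basic hypergeometric series with upper parameters `as` and lower parameters `bs`
(one fewer than the upper ones), base `q` and argument `z`:
`∑_{k ≥ 0} (as)_k / (q, bs)_k z^k`.
If some upper parameter is `q^{-n}`, all terms with `k > n` vanish. -/
noncomputable def basicHypergeometric (as bs : List ℂ) (q z : ℂ) : ℂ :=
  ∑' k : ℕ, qShiftedFactorials q as k / qShiftedFactorials q (q :: bs) k * z ^ k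

/-! Bailey's transformation follows from two uses of Jackson's terminating `₈φ₇` sum, and the `C_r`
transformation is a determinant of Bailey transformations.

Jackson's sum (`jackson_sum`) is proved by induction on `n`, with `e` becoming `e q` at each step:
the term at `n + 1` minus a constant multiple of the term at `n` is a difference in `k` of an
explicit partner whose boundary values vanish (`jacksonTerm_telescoping`). For Bailey, Jackson's sum
with base `λ` expands `(b,c,d)_m / (aq/b,aq/c,aq/d)_m` as a sum over `j ≤ m`. After interchanging
summations, the sum over `m = j + l` is another Jackson sum, with base `a q^{2j}`
(`baileyTerm_resummation`).

For `r` variables, the product over pairs is, up to powers of the `q^{k_i}`, the Vandermonde product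
in `y_i = a q^{k_i} + q^{-k_i}`. Up to a constant it is also the determinant whose column `j` is a
product of `j` linear factors in `y_i` attached to `b` and `r-1-j` attached to `c`
(`det_wellPoisedPoly`). Up to normalization, these factors are what turns `b` into `b q^j` and `c`
into `c q^{r-1-j}` in the summand. By multilinearity the multiple sum is therefore a constant times
a determinant of one-variable sums (`nodeFactor_mul_multiSum`). Since `(b q^j)(c q^{r-1-j})` does
not depend on `j`, Bailey's transformation applies to all entries with the same `λ`, and its
prefactor depends only on the row. Reading the new determinant backwards gives the `λ` series, and
the constants combine in `multi_constant`.

These arguments divide by quantities that the theorem allows to vanish, so they are first run with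
certain parameters and quotients not powers of `q`. The general case follows by moving the
parameters along a curve in `t` that preserves the relations: almost every `t` is generic, and both
sides are continuous at `t = 1`. -/

/-! ### Elementary properties of q-shifted factorials -/

theorem qShiftedFactorial_zero (q a : ℂ) : qShiftedFactorial q a 0 = 1 := by
  simp [qShiftedFactorial]

theorem qShiftedFactorial_succ (q a : ℂ) (k : ℕ) :
    qShiftedFactorial q a (k + 1) = qShiftedFactorial q a k * (1 - a * q ^ k) := by
  simp [qShiftedFactorial, Finset.prod_range_succ]

theorem qShiftedFactorial_add (q a : ℂ) (j l : ℕ) :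
    qShiftedFactorial q a (j + l) = qShiftedFactorial q a j * qShiftedFactorial q (a * q ^ j) l := by
  simp only [qShiftedFactorial, Finset.prod_range_add]
  congr 1
  exact Finset.prod_congr rfl fun i _ => by ring

theorem qShiftedFactorial_mul_shift (q a : ℂ) (k : ℕ) :
    qShiftedFactorial q a k * (1 - a * q ^ k) = (1 - a) * qShiftedFactorial q (a * q) k := by
  rw [← qShiftedFactorial_succ, add_comm, qShiftedFactorial_add]
  simp [qShiftedFactorial]

theorem qShiftedFactorial_ne_zero_iff {q a : ℂ} {n : ℕ} :
    qShiftedFactorial q a n ≠ 0 ↔ ∀ j < n, 1 - a * q ^ j ≠ 0 := by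
  simp [qShiftedFactorial, Finset.prod_ne_zero_iff]

theorem qShiftedFactorial_ne_zero_of_le {q a : ℂ} {k n : ℕ} (h : qShiftedFactorial q a n ≠ 0)
    (hk : k ≤ n) : qShiftedFactorial q a k ≠ 0 := by
  rw [qShiftedFactorial_ne_zero_iff] at *
  exact fun j hj => h j (hj.trans_le hk)

/-! ### Genericity and nonvanishing -/

/-- `x` is not an integral power of `q`. -/
def NotQPower (q x : ℂ) : Prop := ∀ m : ℤ, x ≠ q ^ m

namespace NotQPower

variable {q x : ℂ}

theorem mul_zpow (h : NotQPower q x) (hq : q ≠ 0) (j : ℤ) : NotQPower q (x * q ^ j) := by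
  intro m hm
  refine h (m - j) ?_
  rw [zpow_sub₀ hq, ← hm, mul_div_cancel_right₀ _ (zpow_ne_zero _ hq)]

theorem mul_pow (h : NotQPower q x) (hq : q ≠ 0) (j : ℕ) : NotQPower q (x * q ^ j) := by
  simpa using h.mul_zpow hq j

theorem mul_self (h : NotQPower q x) (hq : q ≠ 0) : NotQPower q (x * q) := by
  simpa using h.mul_pow hq 1

theorem inv (h : NotQPower q x) : NotQPower q x⁻¹ := by
  intro m hm
  refine h (-m) ?_
  rw [zpow_neg, ← hm, inv_inv]

theorem one_sub_ne_zero (h : NotQPower q x) : 1 - x ≠ 0 := by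
  intro h0
  exact h 0 (by rw [zpow_zero]; exact (sub_eq_zero.mp h0).symm)

theorem one_sub_mul_pow_ne_zero (h : NotQPower q x) (hq : q ≠ 0) (j : ℕ) : 1 - x * q ^ j ≠ 0 :=
  (h.mul_pow hq j).one_sub_ne_zero

theorem qShiftedFactorial_ne_zero (h : NotQPower q x) (hq : q ≠ 0) (n : ℕ) :
    qShiftedFactorial q x n ≠ 0 :=
  qShiftedFactorial_ne_zero_iff.mpr fun j _ => h.one_sub_mul_pow_ne_zero hq j

end NotQPower

theorem one_sub_pow_ne_zero {q : ℂ} (hq1 : ‖q‖ < 1) {n : ℕ} (hn : n ≠ 0) : 1 - q ^ n ≠ 0 := by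
  intro h
  have h1 : ‖q ^ n‖ = 1 := by rw [← sub_eq_zero.mp h]; simp
  rw [norm_pow] at h1
  exact (pow_lt_one₀ (norm_nonneg _) hq1 hn).ne h1

theorem one_sub_inv_pow_ne_zero {q : ℂ} (hq1 : ‖q‖ < 1) {n : ℕ} (hn : n ≠ 0) :
    1 - (q ^ n)⁻¹ ≠ 0 := by
  intro h
  refine one_sub_pow_ne_zero hq1 hn ?_
  rw [sub_eq_zero] at h ⊢
  exact (inv_eq_one.mp h.symm).symm

theorem qShiftedFactorial_self_ne_zero {q : ℂ} (hq1 : ‖q‖ < 1) (n : ℕ) :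
    qShiftedFactorial q q n ≠ 0 :=
  qShiftedFactorial_ne_zero_iff.mpr fun j _ => by
    rw [← pow_succ']; exact one_sub_pow_ne_zero hq1 j.succ_ne_zero

theorem qShiftedFactorial_inv_pow_eq_zero {q : ℂ} (hq0 : q ≠ 0) {n k : ℕ} (h : n < k) :
    qShiftedFactorial q (q ^ n)⁻¹ k = 0 := by
  refine Finset.prod_eq_zero (Finset.mem_range.mpr h) ?_
  rw [inv_mul_cancel₀ (pow_ne_zero _ hq0), sub_self]

/-! ### Well-poised quotients -/

/-- The quotient `(b)_k / (aq/b)_k` of a pair of parameters in a well-poised series. -/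
noncomputable def wellPoisedRatio (q a b : ℂ) (k : ℕ) : ℂ :=
  qShiftedFactorial q b k / qShiftedFactorial q (a * q / b) k

theorem wellPoisedRatio_zero (q a b : ℂ) : wellPoisedRatio q a b 0 = 1 := by
  simp [wellPoisedRatio, qShiftedFactorial_zero]

theorem wellPoisedRatio_succ (q a b : ℂ) (k : ℕ) :
    wellPoisedRatio q a b (k + 1) =
      wellPoisedRatio q a b k * ((1 - b * q ^ k) / (1 - a * q / b * q ^ k)) := by
  simp only [wellPoisedRatio, qShiftedFactorial_succ, mul_div_mul_comm]

/-- Splitting off `j` factors gives a well-poised quotient again, with base `a q^{2j}`; this is why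
the inner sum in Bailey's argument is well-poised. -/
theorem wellPoisedRatio_add {q : ℂ} (hq0 : q ≠ 0) (a b : ℂ) (j l : ℕ) :
    wellPoisedRatio q a b (j + l) =
      wellPoisedRatio q a b j * wellPoisedRatio q (a * q ^ (2 * j)) (b * q ^ j) l := by
  have : a * q ^ (2 * j) * q / (b * q ^ j) = a * q / b * q ^ j := by
    have := pow_ne_zero j hq0
    rw [two_mul, pow_add, div_mul_eq_mul_div, ← mul_div_mul_right (a * q * q ^ j) b this]
    ring
  simp only [wellPoisedRatio, qShiftedFactorial_add, mul_div_mul_comm, this]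

/-- The contiguous relation for `b → b q`. It relates consecutive `n` in Jackson's sum and,
iterated, produces the columns of the determinant. -/
theorem wellPoisedRatio_mul_shift {q a b : ℂ} (hq0 : q ≠ 0) {k : ℕ}
    (h1 : qShiftedFactorial q (a * q / b) k ≠ 0) (h2 : qShiftedFactorial q (a / b) k ≠ 0) :
    wellPoisedRatio q a b k * ((1 - b * q ^ k) * (1 - a / b * q ^ k)) =
      wellPoisedRatio q a (b * q) k * ((1 - b) * (1 - a / b)) := by
  have e1 := qShiftedFactorial_mul_shift q b k
  have e2 := qShiftedFactorial_mul_shift q (a / b) k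
  rw [div_mul_eq_mul_div a b q] at e2
  have : a * q / (b * q) = a / b := mul_div_mul_right _ _ hq0
  rw [wellPoisedRatio, wellPoisedRatio, this, div_mul_eq_mul_div (qShiftedFactorial q b k),
    div_mul_eq_mul_div (qShiftedFactorial q (b * q) k), div_eq_div_iff h1 h2]
  linear_combination (1 - a / b * q ^ k) * qShiftedFactorial q (a / b) k * e1 +
    (1 - b) * qShiftedFactorial q (b * q) k * e2

/-! ### Jackson's sum by telescoping -/

/-- The algebraic identity behind the telescoping proof of Jackson's sum. -/
theorem jackson_telescoping_identity {a b c d e Q x : ℂ} (hb : b ≠ 0) (hc : c ≠ 0) (hd : d ≠ 0)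
    (ha : a ≠ 0) (he : e ≠ 0) (hQ : Q ≠ 0) (hrel : a ^ 2 * Q = b * c * d * e)
    (hQ1 : 1 - Q ≠ 0) (hQb : 1 - a * Q / b ≠ 0) (hQc : 1 - a * Q / c ≠ 0)
    (hQd : 1 - a * Q / d ≠ 0) (hae : 1 - e / a ≠ 0) :
    (1 - a * x ^ 2) * x * ((1 - e * x) * (1 - a / e * x) -
      (1 - a * Q / (b * c)) * (1 - a * Q / (b * d)) * (1 - a * Q / (c * d)) /
        ((1 - a * Q / b) * (1 - a * Q / c) * (1 - a * Q / d) * (1 - e / a)) *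
        ((1 - e) * (1 - a / e)) / (1 - Q⁻¹) * ((1 - Q⁻¹ * x) * (1 - a * Q * x))) =
    -(Q * (1 - e * Q)) / ((1 - Q) * (1 - a * Q / b) * (1 - a * Q / c) * (1 - a * Q / d)) *
      ((1 - Q⁻¹ * x) * (1 - a * x) * (1 - b * x) * (1 - c * x) * (1 - d * x) * (1 - e * x) -
        (1 - x) * (1 - a / b * x) * (1 - a / c * x) * (1 - a / d * x) * (1 - a * Q * x) *
          (1 - a / e * x)) := by
  have h1 : (1 - a / e) / (1 - e / a) = -(a / e) := by
    rw [div_eq_iff hae]; field_simp; ring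
  have h2 : (1 - Q⁻¹) = -(1 - Q) / Q := by field_simp; ring
  have key : (1 - a * x ^ 2) * x * ((1 - e * x) * (1 - a / e * x) *
        ((1 - Q) * (1 - a * Q / b) * (1 - a * Q / c) * (1 - a * Q / d)) -
      (1 - a * Q / (b * c)) * (1 - a * Q / (b * d)) * (1 - a * Q / (c * d)) *
        ((1 - e) * (a / e) * Q) * ((1 - Q⁻¹ * x) * (1 - a * Q * x))) =
      -(Q * (1 - e * Q)) *
      ((1 - Q⁻¹ * x) * (1 - a * x) * (1 - b * x) * (1 - c * x) * (1 - d * x) * (1 - e * x) -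
        (1 - x) * (1 - a / b * x) * (1 - a / c * x) * (1 - a / d * x) * (1 - a * Q * x) *
          (1 - a / e * x)) := by
    -- Eliminating `Q` by the balancing condition leaves an identity of rational functions in free
    -- variables.
    obtain rfl : Q = b * c * d * e / a ^ 2 := by field_simp; linear_combination hrel
    field_simp
    ring
  rw [div_mul_eq_mul_div (-(Q * (1 - e * Q))), ← key, h2,
    eq_div_iff (by simp only [mul_ne_zero_iff]; tauto)]
  have h3 : (1 - a / e) = -(a / e) * (1 - e / a) := by rw [← h1, div_mul_cancel₀ _ hae]
  rw [h3]
  generalize 1 - e / a = y4 at *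
  generalize 1 - Q = y0 at *
  generalize 1 - a * Q / b = y1 at *
  generalize 1 - a * Q / c = y2 at *
  generalize 1 - a * Q / d = y3 at *
  generalize a / e = z at *
  generalize hw : 1 - Q⁻¹ * x = w at *
  field_simp

/-- The `k`-th term of the terminating very-well-poised balanced `₈φ₇`. -/
noncomputable def jacksonTerm (q a b c d e : ℂ) (n k : ℕ) : ℂ :=
  (1 - a * q ^ (2 * k)) / (1 - a) *
    (wellPoisedRatio q a a k * wellPoisedRatio q a b k * wellPoisedRatio q a c k *
      wellPoisedRatio q a d k * wellPoisedRatio q a e k * wellPoisedRatio q a (q ^ n)⁻¹ k) * q ^ k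

theorem jacksonTerm_succ {q a b c d e : ℂ} {n k : ℕ} (ha : a ≠ 0)
    (h : 1 - a * q ^ (2 * k) ≠ 0) :
    jacksonTerm q a b c d e n (k + 1) = jacksonTerm q a b c d e n k *
      ((1 - a * (q * q ^ k) ^ 2) / (1 - a * (q ^ k) ^ 2) *
        ((1 - a * q ^ k) / (1 - q * q ^ k) * ((1 - b * q ^ k) / (1 - a * q / b * q ^ k)) *
        ((1 - c * q ^ k) / (1 - a * q / c * q ^ k)) * ((1 - d * q ^ k) / (1 - a * q / d * q ^ k)) *
        ((1 - e * q ^ k) / (1 - a * q / e * q ^ k)) *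
        ((1 - (q ^ n)⁻¹ * q ^ k) / (1 - a * q / (q ^ n)⁻¹ * q ^ k))) * q) := by
  have h0 : a * q / a = q := mul_div_cancel_left₀ _ ha
  have h1 : (1 - a * q ^ (2 * k)) / (1 - a) * ((1 - a * (q * q ^ k) ^ 2) / (1 - a * (q ^ k) ^ 2)) =
      (1 - a * q ^ (2 * (k + 1))) / (1 - a) := by
    rw [mul_comm 2 k, pow_mul] at h
    rw [mul_comm 2 k, pow_mul, mul_comm 2 (k + 1), pow_mul, pow_succ' q k]
    generalize 1 - a * (q ^ k) ^ 2 = y at *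
    field_simp
  simp only [jacksonTerm, wellPoisedRatio_succ, h0, ← h1, pow_succ q k]
  ring

/-- The telescoping partner of `jacksonTerm`. -/
noncomputable def jacksonPartner (q a b c d e : ℂ) (n k : ℕ) : ℂ :=
  jacksonTerm q a b c d (e * q) (n + 1) k *
    ((1 - q ^ k) * (1 - a / b * q ^ k) * (1 - a / c * q ^ k) * (1 - a / d * q ^ k) *
      (1 - a * q ^ (n + 1) * q ^ k)) / ((1 - a * (q ^ k) ^ 2) * q ^ k * (1 - e * q ^ k))

/-- The term ratio brings the partner at `k + 1` back to the term at `k`, so that both ends of the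
difference share a common factor. -/
theorem jacksonPartner_succ {q a b c d e : ℂ} {n k : ℕ} (hq0 : q ≠ 0) (hq1 : ‖q‖ < 1)
    (ha : a ≠ 0)
    (ga : NotQPower q a) (gb : NotQPower q (a / b)) (gc : NotQPower q (a / c))
    (gd : NotQPower q (a / d)) (gae : NotQPower q (a / e)) (ge : NotQPower q e) :
    jacksonPartner q a b c d e n (k + 1) = jacksonTerm q a b c d (e * q) (n + 1) k *
      ((1 - (q ^ (n + 1))⁻¹ * q ^ k) * (1 - a * q ^ k) * (1 - b * q ^ k) * (1 - c * q ^ k) *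
        (1 - d * q ^ k)) / ((1 - a * (q ^ k) ^ 2) * q ^ k * (1 - a / e * q ^ k)) := by
  have z1 := ga.one_sub_mul_pow_ne_zero hq0 (2 * k)
  rw [jacksonPartner, jacksonTerm_succ ha z1]
  have z2 := ga.one_sub_mul_pow_ne_zero hq0 (2 * (k + 1))
  rw [mul_comm 2, pow_mul] at z1 z2
  have z3 := gb.one_sub_mul_pow_ne_zero hq0 (k + 1)
  have z4 := gc.one_sub_mul_pow_ne_zero hq0 (k + 1)
  have z5 := gd.one_sub_mul_pow_ne_zero hq0 (k + 1)
  have z6 := gae.one_sub_mul_pow_ne_zero hq0 k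
  have z7 := ge.one_sub_mul_pow_ne_zero hq0 (k + 1)
  have z8 := one_sub_pow_ne_zero hq1 k.succ_ne_zero
  have z9 := ga.one_sub_mul_pow_ne_zero hq0 (n + 1 + (k + 1))
  have r1 : a * q / b * q ^ k = a / b * q ^ (k + 1) := by ring
  have r2 : a * q / c * q ^ k = a / c * q ^ (k + 1) := by ring
  have r3 : a * q / d * q ^ k = a / d * q ^ (k + 1) := by ring
  have r4 : a * q / (e * q) * q ^ k = a / e * q ^ k := by rw [mul_div_mul_right _ _ hq0]
  have r5 : e * q * q ^ k = e * q ^ (k + 1) := by ring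
  have r6 : a * q / (q ^ (n + 1))⁻¹ * q ^ k = a * q ^ (n + 1 + (k + 1)) := by
    rw [div_inv_eq_mul]; ring
  have r7 : a * q ^ (n + 1) * q ^ (k + 1) = a * q ^ (n + 1 + (k + 1)) := by ring
  have r8 : q * q ^ k = q ^ (k + 1) := by ring
  have r9 : q / q ^ (k + 1) = 1 / q ^ k := by
    rw [← r8, div_mul_eq_div_div, div_self hq0]
  rw [r1, r2, r3, r4, r5, r6, r7, r8]
  have e1 : q ^ (k + 1) ≠ 0 := pow_ne_zero _ hq0
  have e2 : q ^ k ≠ 0 := pow_ne_zero _ hq0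
  generalize 1 - a * (q ^ k) ^ 2 = y1 at *
  generalize 1 - a * (q ^ (k + 1)) ^ 2 = y2 at *
  generalize 1 - a / b * q ^ (k + 1) = y3 at *
  generalize 1 - a / c * q ^ (k + 1) = y4 at *
  generalize 1 - a / d * q ^ (k + 1) = y5 at *
  generalize 1 - a / e * q ^ k = y6 at *
  generalize 1 - e * q ^ (k + 1) = y7 at *
  generalize 1 - q ^ (k + 1) = y8 at *
  generalize 1 - a * q ^ (n + 1 + (k + 1)) = y9 at *
  generalize jacksonTerm q a b c d (e * q) (n + 1) k = t
  generalize 1 - (q ^ (n + 1))⁻¹ * q ^ k = w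
  generalize q ^ (k + 1) = X at *
  generalize q ^ k = x at *
  rw [div_eq_div_iff (by simp only [mul_ne_zero_iff]; tauto)
    (by simp only [mul_ne_zero_iff]; tauto)]
  subst r8
  field_simp

/-- Two contiguous shifts, `e → e q` and `q^{-n-1} → q^{-n}`, compare the summands at `n` and `n +
1`. -/
theorem jacksonTerm_eq {q a b c d e : ℂ} {n k : ℕ} (hq0 : q ≠ 0) (hq1 : ‖q‖ < 1)
    (ga : NotQPower q a) (gae : NotQPower q (a / e)) (ge : NotQPower q e) :
    jacksonTerm q a b c d e n k = jacksonTerm q a b c d (e * q) (n + 1) k *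
      ((1 - e) * (1 - a / e) * ((1 - (q ^ (n + 1))⁻¹ * q ^ k) * (1 - a * q ^ (n + 1) * q ^ k)) /
      ((1 - e * q ^ k) * (1 - a / e * q ^ k) *
        ((1 - (q ^ (n + 1))⁻¹) * (1 - a * q ^ (n + 1))))) := by
  have h1 := wellPoisedRatio_mul_shift (q := q) (a := a) (b := e) (k := k) hq0
    (by rw [← div_mul_eq_mul_div]; exact (gae.mul_self hq0).qShiftedFactorial_ne_zero hq0 _)
    (gae.qShiftedFactorial_ne_zero hq0 _)
  have h2 := wellPoisedRatio_mul_shift (q := q) (a := a) (b := (q ^ (n + 1))⁻¹) (k := k) hq0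
    (by rw [div_inv_eq_mul, mul_assoc, ← pow_succ']
        exact (ga.mul_pow hq0 _).qShiftedFactorial_ne_zero hq0 _)
    (by rw [div_inv_eq_mul]; exact (ga.mul_pow hq0 _).qShiftedFactorial_ne_zero hq0 _)
  have h3 : (q ^ (n + 1))⁻¹ * q = (q ^ n)⁻¹ := by
    rw [pow_succ, mul_inv, inv_mul_cancel_right₀ hq0]
  rw [h3, div_inv_eq_mul] at h2
  have z1 := ge.one_sub_mul_pow_ne_zero hq0 k
  have z2 := gae.one_sub_mul_pow_ne_zero hq0 k
  have z3 := (ga.mul_pow hq0 (n + 1)).one_sub_ne_zero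
  have z4 := one_sub_inv_pow_ne_zero hq1 n.succ_ne_zero
  have h1' : wellPoisedRatio q a e k = wellPoisedRatio q a (e * q) k *
      ((1 - e) * (1 - a / e)) / ((1 - e * q ^ k) * (1 - a / e * q ^ k)) := by
    rw [← h1, mul_div_cancel_right₀ _ (mul_ne_zero z1 z2)]
  have h2' : wellPoisedRatio q a (q ^ n)⁻¹ k = wellPoisedRatio q a (q ^ (n + 1))⁻¹ k *
      ((1 - (q ^ (n + 1))⁻¹ * q ^ k) * (1 - a * q ^ (n + 1) * q ^ k)) /
        ((1 - (q ^ (n + 1))⁻¹) * (1 - a * q ^ (n + 1))) := by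
    rw [h2, mul_div_cancel_right₀ _ (mul_ne_zero z4 z3)]
  rw [jacksonTerm, h1', h2', jacksonTerm]
  simp only [div_eq_mul_inv, mul_inv]
  ac_rfl

/-- Every summand is the term at `n + 1` times a rational function of `x = q^k`, so the claim
reduces to `jackson_telescoping_identity` with `Q = q^{n+1}`. The coefficient of the term at `n` is
the quotient of the closed forms at `n + 1` and `n`, in view of `qShiftedFactorial_quot_succ`. -/
theorem jacksonTerm_telescoping {q a b c d e : ℂ} {n k : ℕ} (hq0 : q ≠ 0) (hq1 : ‖q‖ < 1)
    (ha : a ≠ 0) (hb : b ≠ 0) (hc : c ≠ 0) (hd : d ≠ 0) (he : e ≠ 0)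
    (hrel : a ^ 2 * q ^ (n + 1) = b * c * d * e)
    (ga : NotQPower q a) (gb : NotQPower q (a / b)) (gc : NotQPower q (a / c))
    (gd : NotQPower q (a / d)) (gae : NotQPower q (a / e)) (ge : NotQPower q e) :
    jacksonTerm q a b c d (e * q) (n + 1) k -
      (1 - a * q ^ (n + 1)) * ((1 - a * q ^ (n + 1) / (b * c)) * (1 - a * q ^ (n + 1) / (b * d)) *
        (1 - a * q ^ (n + 1) / (c * d))) / ((1 - a * q ^ (n + 1) / b) *
        (1 - a * q ^ (n + 1) / c) * (1 - a * q ^ (n + 1) / d) * (1 - e / a)) *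
        jacksonTerm q a b c d e n k =
    -(q ^ (n + 1) * (1 - e * q ^ (n + 1))) / ((1 - q ^ (n + 1)) * (1 - a * q ^ (n + 1) / b) *
        (1 - a * q ^ (n + 1) / c) * (1 - a * q ^ (n + 1) / d)) *
      (jacksonPartner q a b c d e n (k + 1) - jacksonPartner q a b c d e n k) := by
  have z1 := ga.one_sub_mul_pow_ne_zero hq0 (2 * k)
  rw [mul_comm 2, pow_mul] at z1
  have z2 := ge.one_sub_mul_pow_ne_zero hq0 k
  have z3 := gae.one_sub_mul_pow_ne_zero hq0 k
  have z4 := (ga.mul_pow hq0 (n + 1)).one_sub_ne_zero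
  have w1 := (gb.mul_pow hq0 (n + 1)).one_sub_ne_zero
  have w2 := (gc.mul_pow hq0 (n + 1)).one_sub_ne_zero
  have w3 := (gd.mul_pow hq0 (n + 1)).one_sub_ne_zero
  have w4 := gae.inv.one_sub_ne_zero
  rw [div_mul_eq_mul_div] at w1 w2 w3
  rw [inv_div] at w4
  have key := jackson_telescoping_identity (x := q ^ k) hb hc hd ha he (pow_ne_zero _ hq0) hrel
    (one_sub_pow_ne_zero hq1 n.succ_ne_zero) w1 w2 w3 w4
  rw [jacksonPartner_succ hq0 hq1 ha ga gb gc gd gae ge,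
    jacksonTerm_eq hq0 hq1 ga gae ge, jacksonPartner]
  have e2 : q ^ k ≠ 0 := pow_ne_zero _ hq0
  generalize jacksonTerm q a b c d (e * q) (n + 1) k = t
  generalize -(q ^ (n + 1) * (1 - e * q ^ (n + 1))) / ((1 - q ^ (n + 1)) * (1 - a * q ^ (n + 1) / b) *
        (1 - a * q ^ (n + 1) / c) * (1 - a * q ^ (n + 1) / d)) = κ at *
  have f1 := one_sub_inv_pow_ne_zero hq1 n.succ_ne_zero
  generalize 1 - a * q ^ (n + 1) / (b * c) = v1 at *
  generalize 1 - a * q ^ (n + 1) / (b * d) = v2 at *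
  generalize 1 - a * q ^ (n + 1) / (c * d) = v3 at *
  generalize 1 - a * q ^ (n + 1) / b = u1 at *
  generalize 1 - a * q ^ (n + 1) / c = u2 at *
  generalize 1 - a * q ^ (n + 1) / d = u3 at *
  generalize 1 - e / a = u4 at *
  generalize 1 - (q ^ (n + 1))⁻¹ = f at *
  generalize 1 - (q ^ (n + 1))⁻¹ * q ^ k = g at *
  generalize 1 - a * q ^ (n + 1) * q ^ k = h at *
  generalize 1 - a * q ^ (n + 1) = y4 at *
  generalize 1 - a / e * q ^ k = y3 at *
  generalize 1 - e * q ^ k = y2 at *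
  generalize 1 - a * (q ^ k) ^ 2 = y1 at *
  generalize 1 - a / e = s at *
  generalize q ^ k = x at *
  have : t * ((y1 * x * (y2 * y3 -
      v1 * v2 * v3 / (u1 * u2 * u3 * u4) * ((1 - e) * s) / f * (g * h))) / (y1 * x * y2 * y3)) =
      t * (κ *
      ((g * (1 - a * x) * (1 - b * x) * (1 - c * x) * (1 - d * x) * y2 -
        (1 - x) * (1 - a / b * x) * (1 - a / c * x) * (1 - a / d * x) * h * y3)) /
        (y1 * x * y2 * y3)) := by rw [key]
  convert this using 1
  · field_simp
  · field_simp

theorem qShiftedFactorial_quot_succ {q a b c d e : ℂ} {n : ℕ} (hb : b ≠ 0) (hc : c ≠ 0)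
    (hd : d ≠ 0) (ha : a ≠ 0) (hrel : a ^ 2 * q ^ (n + 1) = b * c * d * e) :
    1 - a * q / (b * c * d) * q ^ n = 1 - e / a := by
  congr 1
  field_simp
  linear_combination hrel

/-- Jackson's terminating `₈φ₇` summation, for generic parameters. -/
theorem jackson_sum {q : ℂ} (hq0 : q ≠ 0) (hq1 : ‖q‖ < 1) {a b c d : ℂ}
    (ha : a ≠ 0) (hb : b ≠ 0) (hc : c ≠ 0) (hd : d ≠ 0)
    (ga : NotQPower q a) (gb : NotQPower q (a / b)) (gc : NotQPower q (a / c))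
    (gd : NotQPower q (a / d)) (n : ℕ) : ∀ e : ℂ, e ≠ 0 →
    a ^ 2 * q ^ (n + 1) = b * c * d * e → NotQPower q (a / e) → NotQPower q e →
    ∑ k ∈ Finset.range (n + 1), jacksonTerm q a b c d e n k =
      qShiftedFactorial q (a * q) n * (qShiftedFactorial q (a * q / (b * c)) n *
        qShiftedFactorial q (a * q / (b * d)) n * qShiftedFactorial q (a * q / (c * d)) n) /
      (qShiftedFactorial q (a * q / b) n * qShiftedFactorial q (a * q / c) n *
        qShiftedFactorial q (a * q / d) n * qShiftedFactorial q (a * q / (b * c * d)) n) := by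
  induction n with
  | zero =>
    intro e _ _ _ _
    simp [jacksonTerm, wellPoisedRatio_zero, qShiftedFactorial_zero, ga.one_sub_ne_zero]
  | succ n ih =>
    intro e' he' hrel' gae' ge'
    -- The balancing condition at `n + 1` for `e q` is the one at `n` for `e`, with `b`, `c`, `d`
    -- unchanged.
    obtain ⟨e, rfl⟩ : ∃ e, e' = e * q := ⟨e' / q, (div_mul_cancel₀ _ hq0).symm⟩
    have he : e ≠ 0 := left_ne_zero_of_mul he'
    have hrel : a ^ 2 * q ^ (n + 1) = b * c * d * e := by
      apply mul_right_cancel₀ hq0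
      linear_combination hrel'
    have ge : NotQPower q e := by
      have := ge'.mul_zpow hq0 (-1)
      rwa [zpow_neg_one, mul_inv_cancel_right₀ hq0] at this
    have gae : NotQPower q (a / e) := by
      have := gae'.mul_self hq0
      rwa [div_mul_eq_mul_div, mul_div_mul_right _ _ hq0] at this
    have tele := Finset.sum_congr (rfl : Finset.range (n + 1 + 1) = _) fun k _ =>
      jacksonTerm_telescoping (k := k) hq0 hq1 ha hb hc hd he hrel ga gb gc gd gae ge
    rw [← Finset.mul_sum, Finset.sum_range_sub (jacksonPartner q a b c d e n),
      Finset.sum_sub_distrib, ← Finset.mul_sum, Finset.sum_range_succ (jacksonTerm q a b c d e n),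
      ih e he hrel gae ge] at tele
    -- The sum at `n` has one term fewer, so its extra term must vanish; the partner vanishes at the
    -- upper end through `(q^{-n-1})_{n+2}` and at the lower end through `1 - q^0`.
    have v1 : jacksonTerm q a b c d e n (n + 1) = 0 := by
      simp [jacksonTerm, wellPoisedRatio,
        qShiftedFactorial_inv_pow_eq_zero hq0 (Nat.lt_succ_self n)]
    have v2 : jacksonPartner q a b c d e n (n + 1 + 1) = 0 := by
      simp [jacksonPartner, jacksonTerm, wellPoisedRatio,
        qShiftedFactorial_inv_pow_eq_zero hq0 (Nat.lt_succ_self (n + 1))]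
    have v3 : jacksonPartner q a b c d e n 0 = 0 := by simp [jacksonPartner]
    rw [v1, v2, v3, sub_zero, mul_zero, add_zero, sub_eq_zero] at tele
    rw [tele]
    simp only [qShiftedFactorial_succ, qShiftedFactorial_quot_succ hb hc hd ha hrel]
    have s : ∀ y : ℂ, 1 - a * q / y * q ^ n = 1 - a * q ^ (n + 1) / y := fun y => by ring
    simp only [s]
    rw [show a * q * q ^ n = a * q ^ (n + 1) by ring, div_mul_div_comm]
    congr 1 <;> ring

/-! ### Bailey's transformation for generic parameters -/

theorem qShiftedFactorial_div_pow (q z : ℂ) (j : ℕ) :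
    qShiftedFactorial q (z * (q ^ j)⁻¹) j = ∏ s ∈ Finset.range j, (1 - z * (q ^ (s + 1))⁻¹) := by
  -- For `q = 0` the convention `0⁻¹ = 0` makes every factor on both sides equal to `1`.
  by_cases hq : q = 0
  · subst hq
    refine Finset.prod_congr rfl fun s hs => ?_
    have : j ≠ 0 := by have := Finset.mem_range.mp hs; lia
    simp [this]
  rw [qShiftedFactorial, ← Finset.prod_range_reflect]
  refine Finset.prod_congr rfl fun s hs => ?_
  have hs := Finset.mem_range.mp hs
  have : q ^ j = q ^ (j - 1 - s) * q ^ (s + 1) := by rw [← pow_add]; congr 1; lia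
  have h0 := pow_ne_zero (j - 1 - s) hq
  rw [this, mul_inv, mul_assoc, mul_right_comm _ _ (q ^ (j - 1 - s)), inv_mul_cancel₀ h0, one_mul]

/-- Reversing `(z q^{-j})_j` yields `z^j (q/z)_j` up to a sign and a power of `q` independent of
`z`; these cancel in a comparison of `z` with `w`. The cross-multiplied form avoids nonvanishing
hypotheses on the factorials. -/
theorem qShiftedFactorial_reverse_cross {q z w : ℂ} (hq0 : q ≠ 0) (hz : z ≠ 0) (hw : w ≠ 0)
    (j : ℕ) :
    qShiftedFactorial q (z * (q ^ j)⁻¹) j * (w ^ j * qShiftedFactorial q (q / w) j) =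
      qShiftedFactorial q (w * (q ^ j)⁻¹) j * (z ^ j * qShiftedFactorial q (q / z) j) := by
  have e : ∀ y : ℂ, y ^ j = ∏ s ∈ Finset.range j, y := by simp
  rw [qShiftedFactorial_div_pow, qShiftedFactorial_div_pow, e, e, qShiftedFactorial,
    qShiftedFactorial, ← Finset.prod_mul_distrib, ← Finset.prod_mul_distrib,
    ← Finset.prod_mul_distrib, ← Finset.prod_mul_distrib]
  refine Finset.prod_congr rfl fun s _ => ?_
  have := pow_ne_zero s hq0
  field_simp
  ring

theorem sum_range_triangle {M : Type*} [AddCommMonoid M] (n : ℕ) (F : ℕ → ℕ → M) :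
    ∑ m ∈ Finset.range (n + 1), ∑ j ∈ Finset.range (m + 1), F m j =
      ∑ j ∈ Finset.range (n + 1), ∑ l ∈ Finset.range (n - j + 1), F (j + l) j := by
  rw [Finset.sum_comm' (t' := Finset.range (n + 1)) (s' := fun j => Finset.Ico j (n + 1))]
  · refine Finset.sum_congr rfl fun j hj => ?_
    have hj := Finset.mem_range.mp hj
    rw [Finset.sum_Ico_eq_sum_range]
    congr 2
    lia
  · intro x y
    simp only [Finset.mem_range, Finset.mem_Ico]
    lia

/-- The `k`-th term of the terminating very-well-poised balanced `₁₀φ₉`. -/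
noncomputable def baileyTerm (q a b c d e f g : ℂ) (n k : ℕ) : ℂ :=
  (1 - a * q ^ (2 * k)) / (1 - a) *
    (wellPoisedRatio q a a k * wellPoisedRatio q a b k * wellPoisedRatio q a c k *
      wellPoisedRatio q a d k * wellPoisedRatio q a e k * wellPoisedRatio q a f k *
      wellPoisedRatio q a g k * wellPoisedRatio q a (q ^ n)⁻¹ k) * q ^ k

/-- Jackson's sum as an expansion of a product of three well-poised quotients. -/
theorem wellPoisedRatio_mul_expansion {q : ℂ} (hq0 : q ≠ 0) (hq1 : ‖q‖ < 1) {a b c d lam : ℂ}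
    (ha : a ≠ 0) (hb : b ≠ 0) (hc : c ≠ 0) (hd : d ≠ 0) (hl : lam ≠ 0)
    (hlam : lam * (b * c * d) = a ^ 2 * q)
    (ga : NotQPower q a) (gl : NotQPower q lam) (gal : NotQPower q (a / lam))
    (gb : NotQPower q (a / b)) (gc : NotQPower q (a / c)) (gd : NotQPower q (a / d)) (m : ℕ) :
    wellPoisedRatio q a b m * wellPoisedRatio q a c m * wellPoisedRatio q a d m =
      qShiftedFactorial q (a / lam) m / qShiftedFactorial q (lam * q) m *
      ∑ j ∈ Finset.range (m + 1),
        jacksonTerm q lam (lam * b / a) (lam * c / a) (lam * d / a) (a * q ^ m) m j := by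
  have hm := pow_ne_zero m hq0
  have e : ∀ y : ℂ, y ≠ 0 → lam / (lam * y / a) = a / y := fun y hy => by field_simp
  rw [jackson_sum hq0 hq1 hl (by simp [*]) (by simp [*]) (by simp [*]) gl (by rwa [e b hb])
    (by rwa [e c hc]) (by rwa [e d hd]) m (a * q ^ m) (by simp [*])
    (by field_simp; linear_combination (-q ^ m) * hlam)
    (by
      have := gal.inv.mul_zpow hq0 (-m)
      rwa [zpow_neg, zpow_natCast, inv_div, ← div_eq_mul_inv, div_div] at this)
    (ga.mul_pow hq0 m)]
  have e1 : lam * q / (lam * b / a * (lam * c / a)) = d := by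
    field_simp; linear_combination -hlam
  have e2 : lam * q / (lam * b / a * (lam * d / a)) = c := by
    field_simp; linear_combination -hlam
  have e3 : lam * q / (lam * c / a * (lam * d / a)) = b := by
    field_simp; linear_combination -hlam
  have e4 : lam * q / (lam * b / a * (lam * c / a) * (lam * d / a)) = a / lam := by
    field_simp; linear_combination -hlam
  have e' : ∀ y : ℂ, y ≠ 0 → lam * q / (lam * y / a) = a * q / y := fun y hy => by field_simp
  rw [e1, e2, e3, e4, e' b hb, e' c hc, e' d hd]
  have z1 := gal.qShiftedFactorial_ne_zero hq0 m
  have z2 := (gl.mul_self hq0).qShiftedFactorial_ne_zero hq0 m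
  have y1 := (gb.mul_self hq0).qShiftedFactorial_ne_zero hq0 m
  have y2 := (gc.mul_self hq0).qShiftedFactorial_ne_zero hq0 m
  have y3 := (gd.mul_self hq0).qShiftedFactorial_ne_zero hq0 m
  rw [div_mul_eq_mul_div] at y1 y2 y3
  simp only [wellPoisedRatio]
  generalize qShiftedFactorial q (lam * q) m = Y at *
  field_simp

/-- For `m = j + l`, the factors `(a q^m)_j` and `(q^{-m})_j` of the expansion merge with `(a)_m`
and `1/(q)_m`, the latter after reversal. What remains dependent on `l` is a Jackson summand with
base `a q^{2j}`, in which `a/λ` is a new parameter. -/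
theorem baileyTerm_resummation {q : ℂ} (hq0 : q ≠ 0) (hq1 : ‖q‖ < 1) {a e f g lam : ℂ}
    (ha : a ≠ 0) (hl : lam ≠ 0)
    (ga : NotQPower q a) (gl : NotQPower q lam) (gal : NotQPower q (a / lam))
    {n j l : ℕ} (hjn : j ≤ n) :
    (1 - a * q ^ (2 * (j + l))) / (1 - a) * (wellPoisedRatio q a a (j + l) *
      wellPoisedRatio q a e (j + l) * wellPoisedRatio q a f (j + l) *
      wellPoisedRatio q a g (j + l) * wellPoisedRatio q a (q ^ n)⁻¹ (j + l)) * q ^ (j + l) *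
      (qShiftedFactorial q (a / lam) (j + l) / qShiftedFactorial q (lam * q) (j + l)) *
      (wellPoisedRatio q lam (a * q ^ (j + l)) j * wellPoisedRatio q lam (q ^ (j + l))⁻¹ j) =
    (wellPoisedRatio q a e j * wellPoisedRatio q a f j * wellPoisedRatio q a g j *
      wellPoisedRatio q a (q ^ n)⁻¹ j * (qShiftedFactorial q (a * q) (2 * j) /
        qShiftedFactorial q (lam * q) (2 * j)) * (a / lam) ^ j) *
      jacksonTerm q (a * q ^ (2 * j)) (e * q ^ j) (f * q ^ j) (a / lam) (g * q ^ j) (n - j) l := by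
  have hn : (q ^ n)⁻¹ * q ^ j = (q ^ (n - j))⁻¹ := by
    rw [pow_sub₀ _ hq0 hjn, mul_inv, inv_inv]
  have h1 : qShiftedFactorial q a (j + l) * qShiftedFactorial q (a * q ^ (j + l)) j =
      qShiftedFactorial q (a * q) (2 * j) * ((1 - a) / (1 - a * q ^ (2 * j))) *
        qShiftedFactorial q (a * q ^ (2 * j)) l := by
    have := qShiftedFactorial_mul_shift q a (2 * j)
    rw [mul_div_assoc', mul_comm _ (1 - a), ← this,
      mul_div_cancel_right₀ _ (ga.one_sub_mul_pow_ne_zero hq0 _), ← qShiftedFactorial_add,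
      ← qShiftedFactorial_add]
    congr 1; ring
  have h2 : qShiftedFactorial q (lam * q) (j + l) *
      qShiftedFactorial q (lam * q / (q ^ (j + l))⁻¹) j =
      qShiftedFactorial q (lam * q) (2 * j) *
        qShiftedFactorial q (a * q ^ (2 * j) * q / (a / lam)) l := by
    have : a * q ^ (2 * j) * q / (a / lam) = lam * q * q ^ (2 * j) := by field_simp
    rw [div_inv_eq_mul, this, ← qShiftedFactorial_add, ← qShiftedFactorial_add]
    congr 1; ring
  have h3 := qShiftedFactorial_reverse_cross (z := (q ^ l)⁻¹) (w := lam * q / a * (q ^ l)⁻¹) hq0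
    (by simp [hq0]) (by simp [hq0, ha, hl]) j
  have h4 : (q ^ l)⁻¹ * (q ^ j)⁻¹ = (q ^ (j + l))⁻¹ := by rw [pow_add, mul_inv, mul_comm]
  have h5 : q / (lam * q / a * (q ^ l)⁻¹) = a / lam * q ^ l := by
    have := pow_ne_zero l hq0
    field_simp
  have h6 : lam * q / a * (q ^ l)⁻¹ * (q ^ j)⁻¹ = lam * q / (a * q ^ (j + l)) := by
    rw [mul_assoc, h4, ← div_eq_mul_inv, div_div]
  rw [h4, h5, h6, div_inv_eq_mul, mul_pow] at h3
  have h7 : qShiftedFactorial q (a / lam) (j + l) = qShiftedFactorial q (a / lam) l *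
      qShiftedFactorial q (a / lam * q ^ l) j := by rw [add_comm, qShiftedFactorial_add]
  have h8 : qShiftedFactorial q q (j + l) = qShiftedFactorial q q l *
      qShiftedFactorial q (q * q ^ l) j := by rw [add_comm, qShiftedFactorial_add]
  have h9 : (1 - a * q ^ (2 * (j + l))) = 1 - a * q ^ (2 * j) * q ^ (2 * l) := by
    rw [mul_add, pow_add, mul_assoc]
  have z1 := gal.qShiftedFactorial_ne_zero hq0 (j + l)
  have z2 := qShiftedFactorial_self_ne_zero hq1 (j + l)
  rw [h7] at z1
  rw [h8] at z2
  have z3 := (gl.mul_self hq0).qShiftedFactorial_ne_zero hq0 (2 * j)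
  have z4 := (gl.mul_self hq0).qShiftedFactorial_ne_zero hq0 (2 * j + l)
  have z5 := ga.one_sub_ne_zero
  have z6 := ga.one_sub_mul_pow_ne_zero hq0 (2 * j)
  have z7 : qShiftedFactorial q (lam * q / (a * q ^ (j + l))) j ≠ 0 := by
    have := ((gal.inv.mul_zpow hq0 (-(j + l : ℕ))).mul_self hq0).qShiftedFactorial_ne_zero hq0 j
    rw [zpow_neg, zpow_natCast] at this
    convert this using 2
    field_simp
  simp only [jacksonTerm, wellPoisedRatio_add hq0, hn]
  have r1 : wellPoisedRatio q a a j * wellPoisedRatio q (a * q ^ (2 * j)) (a * q ^ j) l =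
      qShiftedFactorial q a (j + l) / qShiftedFactorial q q (j + l) := by
    rw [← wellPoisedRatio_add hq0, wellPoisedRatio, mul_div_cancel_left₀ _ ha]
  have r2 : wellPoisedRatio q (a * q ^ (2 * j)) (a * q ^ (2 * j)) l =
      qShiftedFactorial q (a * q ^ (2 * j)) l / qShiftedFactorial q q l := by
    rw [wellPoisedRatio, mul_div_cancel_left₀ _ (mul_ne_zero ha (pow_ne_zero _ hq0))]
  have r3 : wellPoisedRatio q (a * q ^ (2 * j)) (a / lam) l = qShiftedFactorial q (a / lam) l /
      qShiftedFactorial q (a * q ^ (2 * j) * q / (a / lam)) l := rfl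
  rw [r1, r2, r3, h7, h8, h9]
  have h10 : (a / lam) ^ j = q ^ j / (lam * q / a) ^ j := by
    rw [← div_pow]; congr 1; field_simp
  have y1 : (lam * q / a) ^ j ≠ 0 := pow_ne_zero _ (by simp [ha, hl, hq0])
  have y2 : (q ^ l)⁻¹ ^ j ≠ 0 := by simp [hq0]
  have h11 : qShiftedFactorial q (q ^ (j + l))⁻¹ j /
      qShiftedFactorial q (lam * q / (a * q ^ (j + l))) j =
      qShiftedFactorial q (q * q ^ l) j /
        ((lam * q / a) ^ j * qShiftedFactorial q (a / lam * q ^ l) j) := by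
    rw [div_eq_div_iff z7 (mul_ne_zero y1 (right_ne_zero_of_mul z1))]
    apply mul_right_cancel₀ y2
    linear_combination h3
  have h12 : wellPoisedRatio q lam (a * q ^ (j + l)) j * wellPoisedRatio q lam (q ^ (j + l))⁻¹ j =
      qShiftedFactorial q (a * q ^ (j + l)) j /
        qShiftedFactorial q (lam * q / (q ^ (j + l))⁻¹) j *
      (qShiftedFactorial q (q * q ^ l) j /
        ((lam * q / a) ^ j * qShiftedFactorial q (a / lam * q ^ l) j)) := by
    rw [← h11, wellPoisedRatio, wellPoisedRatio]; ring
  rw [h12, h10]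
  rw [qShiftedFactorial_add] at z4
  have h13 : a * q ^ (2 * j) * q / (a / lam) = lam * q * q ^ (2 * j) := by field_simp
  rw [h13] at h2 ⊢
  have z8 : qShiftedFactorial q (lam * q) (j + l) ≠ 0 :=
    (gl.mul_self hq0).qShiftedFactorial_ne_zero hq0 _
  have z9 : qShiftedFactorial q (lam * q / (q ^ (j + l))⁻¹) j ≠ 0 :=
    right_ne_zero_of_mul (h2 ▸ z4)
  clear h3 h11 h12 h10 h13 r1 r2 r3 h4 h5 h6 h7 h8 h9 hn
  generalize qShiftedFactorial q a (j + l) = A1 at *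
  generalize qShiftedFactorial q (a * q ^ (j + l)) j = A2 at *
  generalize qShiftedFactorial q (lam * q) (j + l) = B1 at *
  generalize qShiftedFactorial q (lam * q / (q ^ (j + l))⁻¹) j = B2 at *
  generalize qShiftedFactorial q (lam * q) (2 * j) = B3 at *
  generalize qShiftedFactorial q (lam * q * q ^ (2 * j)) l = B4 at *
  generalize qShiftedFactorial q (a * q) (2 * j) = A3 at *
  generalize qShiftedFactorial q (a * q ^ (2 * j)) l = A4 at *
  generalize qShiftedFactorial q (a / lam) l = C1 at *
  generalize qShiftedFactorial q (a / lam * q ^ l) j = C2 at *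
  generalize qShiftedFactorial q q l = D1 at *
  generalize qShiftedFactorial q (q * q ^ l) j = D2 at *
  generalize (lam * q / a) ^ j = w at *
  generalize 1 - a * q ^ (2 * j) * q ^ (2 * l) = N at *
  generalize 1 - a * q ^ (2 * j) = N0 at *
  generalize 1 - a = N1 at *
  generalize wellPoisedRatio q a e j = we at *
  generalize wellPoisedRatio q a f j = wf at *
  generalize wellPoisedRatio q a g j = wg at *
  generalize wellPoisedRatio q a (q ^ n)⁻¹ j = wn at *
  generalize wellPoisedRatio q (a * q ^ (2 * j)) (e * q ^ j) l = ve at *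
  generalize wellPoisedRatio q (a * q ^ (2 * j)) (f * q ^ j) l = vf at *
  generalize wellPoisedRatio q (a * q ^ (2 * j)) (g * q ^ j) l = vg at *
  generalize wellPoisedRatio q (a * q ^ (2 * j)) (q ^ (n - j))⁻¹ l = vn at *
  rw [mul_ne_zero_iff] at z1 z2 z4
  rw [pow_add]
  obtain ⟨c1, c2⟩ := z1
  obtain ⟨d1, d2⟩ := z2
  obtain ⟨b3, b4⟩ := z4
  have key : A1 * A2 / (B1 * B2) = A3 * (N1 / N0) * A4 / (B3 * B4) := by rw [h1, h2]
  have inner : A1 / (D1 * D2) * (C1 * C2 / B1) * (A2 / B2 * (D2 / (w * C2))) / N1 =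
      A3 / B3 * (1 / w) * (1 / N0 * (A4 / D1 * (C1 / B4))) := by
    trans (A1 * A2 / (B1 * B2)) * (C1 / (D1 * w)) / N1
    · field_simp
    · rw [key]; field_simp
  calc _ = (N * (we * ve) * (wf * vf) * (wg * vg) * (wn * vn) * (q ^ j * q ^ l)) *
        (A1 / (D1 * D2) * (C1 * C2 / B1) * (A2 / B2 * (D2 / (w * C2))) / N1) := by ring
    _ = _ := by rw [inner]; ring

/-- Bailey's transformation for generic parameters. -/
theorem bailey_transformation_generic {q : ℂ} (hq0 : q ≠ 0) (hq1 : ‖q‖ < 1)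
    {a b c d e f g lam : ℂ} {n : ℕ}
    (ha : a ≠ 0) (hb : b ≠ 0) (hc : c ≠ 0) (hd : d ≠ 0) (he : e ≠ 0) (hf : f ≠ 0) (hg : g ≠ 0)
    (hl : lam ≠ 0)
    (hlam : lam * (b * c * d) = a ^ 2 * q) (hbal : e * f * g = a * lam * q ^ (n + 1))
    (ga : NotQPower q a) (gl : NotQPower q lam) (gal : NotQPower q (a / lam))
    (gb : NotQPower q (a / b)) (gc : NotQPower q (a / c)) (gd : NotQPower q (a / d))
    (gae : NotQPower q (a / e)) (gaf : NotQPower q (a / f)) (gag : NotQPower q (a / g))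
    (gle : NotQPower q (lam / e)) (glf : NotQPower q (lam / f)) (glg : NotQPower q (lam / g))
    (gg : NotQPower q g) (glef : NotQPower q (lam / (e * f))) :
    ∑ k ∈ Finset.range (n + 1), baileyTerm q a b c d e f g n k =
      qShiftedFactorial q (a * q) n * qShiftedFactorial q (lam * q / e) n *
        qShiftedFactorial q (lam * q / f) n * qShiftedFactorial q (a * q / (e * f)) n /
      (qShiftedFactorial q (lam * q) n * qShiftedFactorial q (a * q / e) n *
        qShiftedFactorial q (a * q / f) n * qShiftedFactorial q (lam * q / (e * f)) n) *
      ∑ k ∈ Finset.range (n + 1),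
        baileyTerm q lam (lam * b / a) (lam * c / a) (lam * d / a) e f g n k := by
  have shift : ∀ y z : ℂ, NotQPower q (y / z) → ∀ m, qShiftedFactorial q (y * q / z) m ≠ 0 :=
    fun y z h m => by
      rw [← div_mul_eq_mul_div]; exact (h.mul_self hq0).qShiftedFactorial_ne_zero hq0 m
  -- `L` collects what depends on `j` alone and `F` what depends on `m` alone; only the quotients
  -- for `a q^m` and `q^{-m}` couple the two indices.
  set L : ℕ → ℂ := fun j => (1 - lam * q ^ (2 * j)) / (1 - lam) * (wellPoisedRatio q lam lam j *
    wellPoisedRatio q lam (lam * b / a) j * wellPoisedRatio q lam (lam * c / a) j *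
    wellPoisedRatio q lam (lam * d / a) j) * q ^ j with hL
  set F : ℕ → ℂ := fun m => (1 - a * q ^ (2 * m)) / (1 - a) * (wellPoisedRatio q a a m *
      wellPoisedRatio q a e m * wellPoisedRatio q a f m *
      wellPoisedRatio q a g m * wellPoisedRatio q a (q ^ n)⁻¹ m) * q ^ m *
      (qShiftedFactorial q (a / lam) m / qShiftedFactorial q (lam * q) m) with hF
  have expand : ∀ m, baileyTerm q a b c d e f g n m = ∑ j ∈ Finset.range (m + 1),
      F m * (wellPoisedRatio q lam (a * q ^ m) j * wellPoisedRatio q lam (q ^ m)⁻¹ j) * L j := by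
    intro m
    have h := wellPoisedRatio_mul_expansion hq0 hq1 ha hb hc hd hl hlam ga gl gal gb gc gd m
    have : baileyTerm q a b c d e f g n m = (1 - a * q ^ (2 * m)) / (1 - a) *
        (wellPoisedRatio q a a m * wellPoisedRatio q a e m * wellPoisedRatio q a f m *
        wellPoisedRatio q a g m * wellPoisedRatio q a (q ^ n)⁻¹ m) * q ^ m *
        (wellPoisedRatio q a b m * wellPoisedRatio q a c m * wellPoisedRatio q a d m) := by
      rw [baileyTerm]; ring
    rw [this, h, ← mul_assoc, Finset.mul_sum]
    refine Finset.sum_congr rfl fun j _ => ?_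
    simp only [hF, hL, jacksonTerm]
    ring
  simp only [expand]
  rw [sum_range_triangle, Finset.mul_sum]
  refine Finset.sum_congr rfl fun j hj => ?_
  have hjn : j ≤ n := Nat.lt_succ_iff.mp (Finset.mem_range.mp hj)
  have hqj := pow_ne_zero j hq0
  rw [← Finset.sum_mul]
  simp only [hF]
  rw [Finset.sum_congr rfl fun l _ => baileyTerm_resummation (e := e) (f := f) (g := g)
    (l := l) hq0 hq1 ha hl ga gl gal hjn, ← Finset.mul_sum]
  have sh : ∀ y z : ℂ, y * q ^ (2 * j) / (z * q ^ j) = y / z * q ^ j := fun y z => by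
    rw [two_mul, pow_add, ← mul_assoc, mul_div_mul_right _ _ hqj, div_mul_eq_mul_div]
  rw [jackson_sum hq0 hq1 (by simp [*]) (by simp [*]) (by simp [*]) (by simp [*])
    (ga.mul_pow hq0 _) (by rw [sh]; exact gae.mul_pow hq0 _) (by rw [sh]; exact gaf.mul_pow hq0 _)
    (by
      have : a * q ^ (2 * j) / (a / lam) = lam * q ^ (2 * j) := by field_simp
      rw [this]; exact gl.mul_pow hq0 _) (n - j) (g * q ^ j) (by simp [*])
    (by
      have : q ^ (n + 1) = q ^ j * q ^ (n - j + 1) := by rw [← pow_add]; congr 1; lia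
      rw [this] at hbal
      field_simp
      rw [two_mul, pow_add]
      linear_combination (-(q ^ j) ^ 3) * hbal)
    (by rw [sh]; exact gag.mul_pow hq0 _) (gg.mul_pow hq0 _)]
  obtain ⟨N, rfl⟩ : ∃ N, n = j + N := ⟨n - j, by lia⟩
  rw [Nat.add_sub_cancel_left]
  have a1 : a * q ^ (2 * j) * q = a * q * q ^ (2 * j) := by ring
  have a2 : a * q * q ^ (2 * j) / (e * q ^ j * (f * q ^ j)) = a * q / (e * f) := by
    rw [two_mul, pow_add]; field_simp
  have a3 : ∀ y, y ≠ 0 → a * q * q ^ (2 * j) / (y * q ^ j * (a / lam)) = lam * q / y * q ^ j :=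
    fun y hy => by rw [two_mul, pow_add]; field_simp
  have a4 : ∀ y, a * q * q ^ (2 * j) / (y * q ^ j) = a * q / y * q ^ j := fun y => sh _ _
  have a5 : a * q * q ^ (2 * j) / (a / lam) = lam * q * q ^ (2 * j) := by field_simp
  have a6 : a * q * q ^ (2 * j) / (e * q ^ j * (f * q ^ j) * (a / lam)) = lam * q / (e * f) := by
    rw [two_mul, pow_add]; field_simp
  rw [a1, a2, a3 e he, a3 f hf, a4, a4, a5, a6]
  have dbl : ∀ y, qShiftedFactorial q (y * q) (2 * j) * qShiftedFactorial q (y * q * q ^ (2 * j)) N =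
      qShiftedFactorial q (y * q) (j + N) * qShiftedFactorial q (y * q / (q ^ (j + N))⁻¹) j :=
    fun y => by
      rw [div_inv_eq_mul, ← qShiftedFactorial_add, ← qShiftedFactorial_add]; congr 1; ring
  have hA := dbl a
  have hB := dbl lam
  -- By the balancing condition, the last `j` factors of `(aq/ef)_n` and `(λq/ef)_n` are reversals
  -- of `(λq/g)_j` and `(aq/g)_j`, up to powers; this turns the denominator `(aq/g)_j` into
  -- `(λq/g)_j`.
  have b1 : a * q / (e * f) * q ^ N = g / lam * (q ^ j)⁻¹ := by
    field_simp
    rw [pow_succ, pow_add] at hbal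
    linear_combination -hbal
  have b2 : lam * q / (e * f) * q ^ N = g / a * (q ^ j)⁻¹ := by
    field_simp
    rw [pow_succ, pow_add] at hbal
    linear_combination -hbal
  have hG := qShiftedFactorial_reverse_cross (z := g / lam) (w := g / a) hq0 (by simp [*])
    (by simp [*]) j
  have b3 : ∀ y, q / (g / y) = y * q / g := fun y => by rw [div_div_eq_mul_div, mul_comm]
  have b4 : (g / lam) ^ j = (g / a) ^ j * (a / lam) ^ j := by
    rw [← mul_pow]; congr 1; field_simp
  have b5 : (g / a) ^ j ≠ 0 := pow_ne_zero _ (by simp [*])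
  rw [b3, b3, b4, ← b1, ← b2] at hG
  replace hG : qShiftedFactorial q (a * q / (e * f) * q ^ N) j * qShiftedFactorial q (a * q / g) j =
      qShiftedFactorial q (lam * q / (e * f) * q ^ N) j * (a / lam) ^ j *
        qShiftedFactorial q (lam * q / g) j := by
    apply mul_right_cancel₀ b5
    linear_combination hG
  have c1 := qShiftedFactorial_add q (lam * q / e) j N
  have c2 := qShiftedFactorial_add q (lam * q / f) j N
  have c3 := qShiftedFactorial_add q (a * q / e) j N
  have c4 := qShiftedFactorial_add q (a * q / f) j N
  have c5 := qShiftedFactorial_add q (a * q / (e * f)) N j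
  have c6 := qShiftedFactorial_add q (lam * q / (e * f)) N j
  rw [add_comm N j] at c5 c6
  have d1 := shift _ _ gae (j + N)
  have d2 := shift _ _ gaf (j + N)
  have d3 := shift _ _ gle (j + N)
  have d4 := shift _ _ glf (j + N)
  have d5 := shift _ _ gag j
  have d6 := shift _ _ glg j
  have d7 := shift _ _ glef (j + N)
  have d8 := (gl.mul_self hq0).qShiftedFactorial_ne_zero hq0 (j + N)
  have d9 : qShiftedFactorial q (lam * q / (q ^ (j + N))⁻¹) j ≠ 0 := by
    rw [div_inv_eq_mul]
    exact ((gl.mul_self hq0).mul_pow hq0 _).qShiftedFactorial_ne_zero hq0 j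
  have d10 : qShiftedFactorial q (a * q / (q ^ (j + N))⁻¹) j ≠ 0 := by
    rw [div_inv_eq_mul]
    exact ((ga.mul_self hq0).mul_pow hq0 _).qShiftedFactorial_ne_zero hq0 j
  rw [c3] at d1
  rw [c4] at d2
  rw [c1] at d3
  rw [c2] at d4
  rw [c6] at d7
  rw [mul_ne_zero_iff] at d1 d2 d3 d4 d7
  have hR : baileyTerm q lam (lam * b / a) (lam * c / a) (lam * d / a) e f g (j + N) j =
      (wellPoisedRatio q lam e j * wellPoisedRatio q lam f j * wellPoisedRatio q lam g j *
        wellPoisedRatio q lam (q ^ (j + N))⁻¹ j) * L j := by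
    rw [baileyTerm, hL]; ring
  rw [hR]
  refine Eq.trans ?_ (mul_assoc _ _ _)
  congr 1
  simp only [wellPoisedRatio]
  rw [c1, c2, c3, c4, c5, c6]
  have hAB : qShiftedFactorial q (a * q) (2 * j) / qShiftedFactorial q (lam * q) (2 * j) *
      (qShiftedFactorial q (a * q * q ^ (2 * j)) N / qShiftedFactorial q (lam * q * q ^ (2 * j)) N) =
      qShiftedFactorial q (a * q) (j + N) * qShiftedFactorial q (a * q / (q ^ (j + N))⁻¹) j /
        (qShiftedFactorial q (lam * q) (j + N) *
          qShiftedFactorial q (lam * q / (q ^ (j + N))⁻¹) j) := by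
    rw [div_mul_div_comm, hA, hB]
  have hG' : qShiftedFactorial q (a * q / (e * f) * q ^ N) j /
      qShiftedFactorial q (lam * q / (e * f) * q ^ N) j =
      (a / lam) ^ j * qShiftedFactorial q (lam * q / g) j / qShiftedFactorial q (a * q / g) j := by
    rw [div_eq_div_iff d7.2 d5, hG]; ring
  clear hA hB hG c1 c2 c3 c4 c5 c6 dbl a1 a2 a3 a4 a5 a6 b1 b2 b3 b4 hR sh shift expand
  generalize qShiftedFactorial q (a * q / (q ^ (j + N))⁻¹) j = A1 at *
  generalize qShiftedFactorial q (lam * q / (q ^ (j + N))⁻¹) j = A2 at *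
  generalize qShiftedFactorial q (q ^ (j + N))⁻¹ j = A3 at *
  generalize qShiftedFactorial q (a * q) (j + N) = A4 at *
  generalize qShiftedFactorial q (lam * q) (j + N) = A5 at *
  generalize qShiftedFactorial q (a * q) (2 * j) = A6 at *
  generalize qShiftedFactorial q (lam * q) (2 * j) = A7 at *
  generalize qShiftedFactorial q (a * q * q ^ (2 * j)) N = A8 at *
  generalize qShiftedFactorial q (lam * q * q ^ (2 * j)) N = A9 at *
  generalize qShiftedFactorial q (a * q / (e * f) * q ^ N) j = B1 at *
  generalize qShiftedFactorial q (lam * q / (e * f) * q ^ N) j = B2 at *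
  generalize qShiftedFactorial q (a * q / (e * f)) N = B3 at *
  generalize qShiftedFactorial q (lam * q / (e * f)) N = B4 at *
  generalize qShiftedFactorial q (a * q / g) j = B5 at *
  generalize qShiftedFactorial q (lam * q / g) j = B6 at *
  generalize qShiftedFactorial q (a * q / e) j = C1 at *
  generalize qShiftedFactorial q (a * q / f) j = C2 at *
  generalize qShiftedFactorial q (lam * q / e) j = C3 at *
  generalize qShiftedFactorial q (lam * q / f) j = C4 at *
  generalize qShiftedFactorial q (a * q / e * q ^ j) N = C5 at *
  generalize qShiftedFactorial q (a * q / f * q ^ j) N = C6 at *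
  generalize qShiftedFactorial q (lam * q / e * q ^ j) N = C7 at *
  generalize qShiftedFactorial q (lam * q / f * q ^ j) N = C8 at *
  generalize qShiftedFactorial q e j = D1 at *
  generalize qShiftedFactorial q f j = D2 at *
  generalize qShiftedFactorial q g j = D3 at *
  generalize (a / lam) ^ j = w at *
  obtain ⟨x1, x5⟩ := d1
  obtain ⟨x2, x6⟩ := d2
  obtain ⟨x3, x7⟩ := d3
  obtain ⟨x4, x8⟩ := d4
  calc _ = (A6 / A7 * (A8 / A9)) * (D1 * D2 * D3 * A3 * B3 / B4 * C7 * C8 * w) /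
        (C1 * C2 * B5 * A1 * C5 * C6) := by ring
    _ = A4 * A1 / (A5 * A2) * (D1 * D2 * D3 * A3 * B3 / B4 * C7 * C8 * w) /
        (C1 * C2 * B5 * A1 * C5 * C6) := by rw [hAB]
    _ = A4 / (A5 * A2) * (D1 * D2 * D3 * A3 * B3 / B4 * C7 * C8) /
        (C1 * C2 * C5 * C6) * (w * B6 / B5) / B6 := by field_simp
    _ = A4 / (A5 * A2) * (D1 * D2 * D3 * A3 * B3 / B4 * C7 * C8) /
        (C1 * C2 * C5 * C6) * (B1 / B2) / B6 := by rw [hG']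
    _ = A4 / (A5 * A2) * (D1 * D2 * D3 * A3 * B3 / B4 * C7 * C8) /
        (C1 * C2 * C5 * C6) * (B1 / B2) / B6 * ((C3 / C3) * (C4 / C4)) := by
      rw [div_self x3, div_self x4, mul_one, mul_one]
    _ = _ := by ring

/-! ### Removing genericity from Bailey's transformation -/

-- Each exponent `m` excludes only the roots of a nonzero polynomial, hence all `m` together exclude
-- a countable set.
open MeasureTheory in
theorem ae_notQPower (q : ℂ) {u : ℂ} (hu : u ≠ 0) {N : ℕ} (hN : N ≠ 0) :
    ∀ᵐ t : ℂ, NotQPower q (u * t ^ N) := by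
  simp only [NotQPower, ae_all_iff]
  intro m
  have hf : {t : ℂ | u * t ^ N = q ^ m}.Finite := by
    refine (Polynomial.nthRoots N (q ^ m / u)).toFinset.finite_toSet.subset fun t ht => ?_
    simp only [Finset.mem_coe, Multiset.mem_toFinset,
      Polynomial.mem_nthRoots (Nat.pos_of_ne_zero hN)]
    rw [eq_div_iff hu, mul_comm]
    exact ht
  exact hf.countable.ae_notMem volume

open MeasureTheory in
theorem ae_ne_zero_complex : ∀ᵐ t : ℂ, t ≠ 0 :=
  (Set.countable_singleton (0 : ℂ)).ae_notMem volume

-- A conull set is dense, so `t₀` is a limit of points where the functions agree.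
open MeasureTheory Topology in
theorem eq_of_ae_eq_of_continuousAt {F G : ℂ → ℂ} {t₀ : ℂ} (hF : ContinuousAt F t₀)
    (hG : ContinuousAt G t₀) (h : ∀ᵐ t : ℂ, F t = G t) : F t₀ = G t₀ := by
  have hd : Dense {t | F t = G t} := Measure.dense_of_ae h
  have hne : (𝓝[{t | F t = G t}] t₀).NeBot := mem_closure_iff_nhdsWithin_neBot.mp (hd t₀)
  refine tendsto_nhds_unique (l := 𝓝[{t | F t = G t}] t₀) (hF.tendsto.mono_left nhdsWithin_le_nhds)
    ((hG.tendsto.mono_left nhdsWithin_le_nhds).congr' ?_)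
  filter_upwards [self_mem_nhdsWithin] with t ht
  exact ht.symm

@[fun_prop]
theorem continuous_qShiftedFactorial (q : ℂ) (k : ℕ) :
    Continuous fun x => qShiftedFactorial q x k := by
  unfold qShiftedFactorial
  fun_prop

theorem ContinuousAt.qShiftedFactorial {X : Type*} [TopologicalSpace X] {α : X → ℂ} {t : X}
    (h : ContinuousAt α t) (q : ℂ) (k : ℕ) :
    ContinuousAt (fun s => _root_.qShiftedFactorial q (α s) k) t :=
  (continuous_qShiftedFactorial q k).continuousAt.comp h

theorem ContinuousAt.wellPoisedRatio {X : Type*} [TopologicalSpace X] {α β : X → ℂ} {t : X}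
    (hα : ContinuousAt α t) (hβ : ContinuousAt β t) {q : ℂ} {k n : ℕ} (hk : k ≤ n)
    (h0 : β t ≠ 0) (h : _root_.qShiftedFactorial q (α t * q / β t) n ≠ 0) :
    ContinuousAt (fun s => _root_.wellPoisedRatio q (α s) (β s) k) t :=
  (hβ.qShiftedFactorial q k).div
    (((hα.mul continuousAt_const).div hβ h0).qShiftedFactorial q k)
    (qShiftedFactorial_ne_zero_of_le h hk)

theorem ContinuousAt.baileyTerm {X : Type*} [TopologicalSpace X] {a b c d e f g : X → ℂ} {t : X}
    {q : ℂ} (hq0 : q ≠ 0) (hq1 : ‖q‖ < 1) {k n : ℕ} (hk : k ≤ n)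
    (ha : ContinuousAt a t) (hb : ContinuousAt b t) (hc : ContinuousAt c t)
    (hd : ContinuousAt d t) (he : ContinuousAt e t) (hf : ContinuousAt f t)
    (hg : ContinuousAt g t) (a0 : a t ≠ 0) (a1 : a t ≠ 1)
    (b0 : b t ≠ 0) (c0 : c t ≠ 0) (d0 : d t ≠ 0) (e0 : e t ≠ 0) (f0 : f t ≠ 0) (g0 : g t ≠ 0)
    (zb : _root_.qShiftedFactorial q (a t * q / b t) n ≠ 0)
    (zc : _root_.qShiftedFactorial q (a t * q / c t) n ≠ 0)
    (zd : _root_.qShiftedFactorial q (a t * q / d t) n ≠ 0)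
    (ze : _root_.qShiftedFactorial q (a t * q / e t) n ≠ 0)
    (zf : _root_.qShiftedFactorial q (a t * q / f t) n ≠ 0)
    (zg : _root_.qShiftedFactorial q (a t * q / g t) n ≠ 0)
    (zn : _root_.qShiftedFactorial q (a t * q ^ (1 + n)) n ≠ 0) :
    ContinuousAt (fun s => _root_.baileyTerm q (a s) (b s) (c s) (d s) (e s) (f s) (g s) n k) t := by
  have h1 := ha.wellPoisedRatio ha hk a0 (q := q)
    (by rw [mul_div_cancel_left₀ _ a0]; exact qShiftedFactorial_self_ne_zero hq1 n)
  have h2 := ha.wellPoisedRatio hb hk b0 zb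
  have h3 := ha.wellPoisedRatio hc hk c0 zc
  have h4 := ha.wellPoisedRatio hd hk d0 zd
  have h5 := ha.wellPoisedRatio he hk e0 ze
  have h6 := ha.wellPoisedRatio hf hk f0 zf
  have h7 := ha.wellPoisedRatio hg hk g0 zg
  have h8 := ha.wellPoisedRatio (continuousAt_const (y := (q ^ n)⁻¹)) hk (by simp [hq0]) (q := q)
    (by rw [div_inv_eq_mul, mul_assoc, ← pow_succ', add_comm n 1]; exact zn)
  unfold _root_.baileyTerm
  have h9 : ContinuousAt (fun s => (1 - a s * q ^ (2 * k)) / (1 - a s)) t :=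
    (continuousAt_const.sub (ha.mul continuousAt_const)).div (continuousAt_const.sub ha)
      (sub_ne_zero.mpr a1.symm)
  exact (h9.mul (((((((h1.mul h2).mul h3).mul h4).mul h5).mul h6).mul h7).mul h8)).mul
    continuousAt_const

/-- The product in front of the right-hand side of Bailey's transformation. -/
noncomputable def baileyFactor (q a lam e f : ℂ) (n : ℕ) : ℂ :=
  qShiftedFactorial q (a * q) n * qShiftedFactorial q (lam * q / e) n *
        qShiftedFactorial q (lam * q / f) n * qShiftedFactorial q (a * q / (e * f)) n /
    (qShiftedFactorial q (lam * q) n * qShiftedFactorial q (a * q / e) n *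
        qShiftedFactorial q (a * q / f) n * qShiftedFactorial q (lam * q / (e * f)) n)

/-- Bailey's transformation of terminating very-well-poised balanced `₁₀φ₉` series. -/
theorem bailey_transformation {q : ℂ} (hq0 : q ≠ 0) (hq1 : ‖q‖ < 1)
    {a b c d e f g lam : ℂ} {n : ℕ}
    (ha : a ≠ 0) (hb : b ≠ 0) (hc : c ≠ 0) (hd : d ≠ 0) (he : e ≠ 0) (hf : f ≠ 0) (hg : g ≠ 0)
    (hl : lam ≠ 0)
    (hlam : lam * (b * c * d) = a ^ 2 * q) (hbal : e * f * g = a * lam * q ^ (n + 1))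
    (ha1 : a ≠ 1) (hl1 : lam ≠ 1)
    (zb : qShiftedFactorial q (a * q / b) n ≠ 0) (zc : qShiftedFactorial q (a * q / c) n ≠ 0)
    (zd : qShiftedFactorial q (a * q / d) n ≠ 0) (ze : qShiftedFactorial q (a * q / e) n ≠ 0)
    (zf : qShiftedFactorial q (a * q / f) n ≠ 0) (zg : qShiftedFactorial q (a * q / g) n ≠ 0)
    (zn : qShiftedFactorial q (a * q ^ (1 + n)) n ≠ 0)
    (ye : qShiftedFactorial q (lam * q / e) n ≠ 0)
    (yf : qShiftedFactorial q (lam * q / f) n ≠ 0) (yg : qShiftedFactorial q (lam * q / g) n ≠ 0)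
    (yn : qShiftedFactorial q (lam * q ^ (1 + n)) n ≠ 0)
    (yl : qShiftedFactorial q (lam * q) n ≠ 0)
    (yef : qShiftedFactorial q (lam * q / (e * f)) n ≠ 0) :
    ∑ k ∈ Finset.range (n + 1), baileyTerm q a b c d e f g n k =
      baileyFactor q a lam e f n *
      ∑ k ∈ Finset.range (n + 1),
        baileyTerm q lam (lam * b / a) (lam * c / a) (lam * d / a) e f g n k := by
  -- The deformation `a t`, `λ t²`, `g t³` with `b, c, d, e, f` fixed preserves both relations and
  -- moves every quantity required to be generic with a nonzero power of `t`.
  have cA : ContinuousAt (fun t : ℂ => a * t) 1 := by fun_prop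
  have cL : ContinuousAt (fun t : ℂ => lam * t ^ 2) 1 := by fun_prop
  have cG : ContinuousAt (fun t : ℂ => g * t ^ 3) 1 := by fun_prop
  have cdiv : ∀ y : ℂ, ContinuousAt (fun t : ℂ => lam * t ^ 2 * y / (a * t)) 1 := fun y =>
    (cL.mul continuousAt_const).div cA (by simpa using ha)
  have cancel : ∀ y : ℂ, y ≠ 0 → lam * q / (lam * y / a) = a * q / y := fun y hy => by field_simp
  have hF : ContinuousAt (fun t : ℂ => ∑ k ∈ Finset.range (n + 1),
      baileyTerm q (a * t) b c d e f (g * t ^ 3) n k) 1 := by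
    refine tendsto_finsetSum _ fun k hk => ?_
    have hk := Nat.lt_succ_iff.mp (Finset.mem_range.mp hk)
    exact ContinuousAt.baileyTerm hq0 hq1 hk cA continuousAt_const continuousAt_const
      continuousAt_const continuousAt_const continuousAt_const cG
      (by simpa) (by simpa) hb hc hd he hf (by simpa) (by simpa) (by simpa) (by simpa) (by simpa)
      (by simpa) (by simpa) (by simpa)
  have hG : ContinuousAt (fun t : ℂ => ∑ k ∈ Finset.range (n + 1),
      baileyTerm q (lam * t ^ 2) (lam * t ^ 2 * b / (a * t)) (lam * t ^ 2 * c / (a * t))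
        (lam * t ^ 2 * d / (a * t)) e f (g * t ^ 3) n k) 1 := by
    refine tendsto_finsetSum _ fun k hk => ?_
    have hk := Nat.lt_succ_iff.mp (Finset.mem_range.mp hk)
    exact ContinuousAt.baileyTerm hq0 hq1 hk cL (cdiv b) (cdiv c) (cdiv d) continuousAt_const
      continuousAt_const cG (by simpa) (by simpa) (by simp [*]) (by simp [*]) (by simp [*])
      he hf (by simpa) (by simpa [cancel b hb]) (by simpa [cancel c hc]) (by simpa [cancel d hd])
      (by simpa) (by simpa) (by simpa) (by simpa)
  have hP : ContinuousAt (fun t : ℂ => baileyFactor q (a * t) (lam * t ^ 2) e f n) 1 := by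
    unfold baileyFactor
    refine ContinuousAt.div ?_ ?_ (by simp [*])
    · exact Continuous.continuousAt (by fun_prop)
    · exact Continuous.continuousAt (by fun_prop)
  have := eq_of_ae_eq_of_continuousAt hF (hP.mul hG) ?_
  · simpa using this
  have gen : ∀ {u : ℂ} (_ : u ≠ 0) {N : ℕ} (_ : N ≠ 0), ∀ᵐ t : ℂ, NotQPower q (u * t ^ N) :=
    fun hu _ hN => ae_notQPower q hu hN
  filter_upwards [ae_ne_zero_complex, gen ha one_ne_zero, gen hl two_ne_zero,
    gen (div_ne_zero hl ha) one_ne_zero, gen (div_ne_zero ha hb) one_ne_zero,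
    gen (div_ne_zero ha hc) one_ne_zero, gen (div_ne_zero ha hd) one_ne_zero,
    gen (div_ne_zero ha he) one_ne_zero, gen (div_ne_zero ha hf) one_ne_zero,
    gen (div_ne_zero hg ha) two_ne_zero, gen (div_ne_zero hl he) two_ne_zero,
    gen (div_ne_zero hl hf) two_ne_zero, gen (div_ne_zero hg hl) one_ne_zero,
    gen hg three_ne_zero, gen (div_ne_zero hl (mul_ne_zero he hf)) two_ne_zero]
    with t t0 k1 k2 k3 k4 k5 k6 k7 k8 k9 k10 k11 k12 k13 k14
  refine bailey_transformation_generic hq0 hq1 (by simp [*]) hb hc hd he hf (by simp [*])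
    (by simp [*]) (by linear_combination t ^ 2 * hlam) (by linear_combination t ^ 3 * hbal)
    (by simpa using k1) k2 ?_ ?_ ?_ ?_ ?_ ?_ ?_ ?_ ?_ ?_ k13 ?_
  · convert k3.inv using 1; field_simp
  · convert k4 using 1; ring
  · convert k5 using 1; ring
  · convert k6 using 1; ring
  · convert k7 using 1; ring
  · convert k8 using 1; ring
  · convert k9.inv using 1; field_simp
  · convert k10 using 1; ring
  · convert k11 using 1; ring
  · convert k12.inv using 1; field_simp
  · convert k14 using 1; ring

/-! ### Determinants and the type C Vandermonde product -/

open Polynomial in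
theorem det_eval_eq_det_vandermonde_mul {R : Type*} [CommRing R] {r : ℕ} (p : Fin r → R[X])
    (hp : ∀ j, (p j).natDegree < r) (y : Fin r → R) :
    (Matrix.of fun i j => (p j).eval (y i)).det =
      (Matrix.vandermonde y).det * (Matrix.of fun m j : Fin r => (p j).coeff m).det := by
  rw [← Matrix.det_mul]
  congr 1
  ext i j
  rw [Matrix.of_apply, eval_eq_sum_range' (hp j), Matrix.mul_apply,
    ← Fin.sum_univ_eq_sum_range (fun m => (p j).coeff m * y i ^ m) r]
  exact Finset.sum_congr rfl fun m _ => by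
    rw [Matrix.vandermonde_apply, Matrix.of_apply, mul_comm]

-- All columns are polynomials of degree below `r`, so the determinant is a constant times the
-- Vandermonde product. The constant is read off at `y = β`: the matrix is then lower triangular,
-- and its diagonal contains the Vandermonde product of the `β`, which cancels since they are
-- distinct.
open Polynomial in
theorem det_two_newton_bases {K : Type*} [Field K] {r : ℕ} (β γ : ℕ → K)
    (hβ : ∀ i < r, ∀ j < i, β i ≠ β j) (y : Fin r → K) :
    (Matrix.of fun i j : Fin r => (∏ s ∈ Finset.range j, (y i - β s)) *
      ∏ t ∈ Finset.range (r - 1 - j), (y i - γ t)).det =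
    (∏ i ∈ Finset.range r, ∏ t ∈ Finset.range (r - 1 - i), (β i - γ t)) *
      ∏ i : Fin r, ∏ j ∈ Finset.Ioi i, (y j - y i) := by
  set p : Fin r → K[X] := fun j => (∏ s ∈ Finset.range j, (X - C (β s))) *
    ∏ t ∈ Finset.range (r - 1 - j), (X - C (γ t)) with hp
  have hdeg : ∀ j, (p j).natDegree < r := by
    intro j
    have h1 := j.isLt
    refine lt_of_le_of_lt natDegree_mul_le ?_
    rw [natDegree_prod_of_monic _ _ fun i _ => monic_X_sub_C _,
      natDegree_prod_of_monic _ _ fun i _ => monic_X_sub_C _]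
    simp
    lia
  have heval : ∀ z : Fin r → K, (Matrix.of fun i j : Fin r =>
      (∏ s ∈ Finset.range j, (z i - β s)) * ∏ t ∈ Finset.range (r - 1 - j), (z i - γ t)) =
      Matrix.of fun i j => (p j).eval (z i) := by
    intro z
    ext i j
    simp [hp, eval_prod]
  have hz := det_eval_eq_det_vandermonde_mul p hdeg (fun i => β i)
  have htri : (Matrix.of fun i j : Fin r => (p j).eval (β i)).det =
      (∏ i ∈ Finset.range r, ∏ t ∈ Finset.range (r - 1 - i), (β i - γ t)) *
        (Matrix.vandermonde fun i : Fin r => β i).det := by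
    rw [← heval fun i => β i, Matrix.det_of_isLowerTriangular, Matrix.det_vandermonde,
      ← Fin.prod_univ_eq_prod_range
        (fun i => ∏ t ∈ Finset.range (r - 1 - i), (β i - γ t)) r, mul_comm]
    · simp only [Matrix.of_apply]
      rw [Finset.prod_mul_distrib]
      congr 1
      rw [Finset.prod_comm' (t' := Finset.univ) (s' := fun j : Fin r => Finset.Iio j)]
      · refine Finset.prod_congr rfl fun i _ => ?_
        rw [← Nat.Iio_eq_range, ← Fin.map_valEmbedding_Iio, Finset.prod_map]
        rfl
      · intro i j
        simp
    · intro i j hij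
      rw [Matrix.of_apply, Finset.prod_eq_zero (i := (i : ℕ)), zero_mul]
      · simpa using hij
      · exact sub_self _
  have hV : (Matrix.vandermonde fun i : Fin r => β i).det ≠ 0 := by
    rw [Matrix.det_vandermonde]
    refine Finset.prod_ne_zero_iff.mpr fun i _ => Finset.prod_ne_zero_iff.mpr fun j hj => ?_
    exact sub_ne_zero.mpr (hβ j j.isLt i (by simpa using hj))
  rw [htri, mul_comm] at hz
  rw [heval, det_eval_eq_det_vandermonde_mul p hdeg, ← mul_left_cancel₀ hV hz,
    Matrix.det_vandermonde, mul_comm]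

theorem prod_pairs_mul {M : Type*} [CommMonoid M] {r : ℕ} (x : Fin r → M) :
    ∏ i : Fin r, ∏ j ∈ Finset.Ioi i, (x i * x j) = ∏ i : Fin r, x i ^ (r - 1) := by
  simp only [Finset.prod_mul_distrib]
  rw [Finset.prod_comm' (t' := Finset.univ) (s' := fun j : Fin r => Finset.Iio j)
    (f := fun i j => x j), ← Finset.prod_mul_distrib]
  · refine Finset.prod_congr rfl fun i _ => ?_
    rw [Finset.prod_const, Finset.prod_const, ← pow_add, Fin.card_Ioi, Fin.card_Iio]
    congr 1
    have := i.isLt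
    lia
  · intro i j
    simp

/-- The product `(bx)_j (a q^{1-j} x / b)_j`, a polynomial in `x`. -/
noncomputable def wellPoisedPoly (q a b : ℂ) (j : ℕ) (x : ℂ) : ℂ :=
  ∏ s ∈ Finset.range j, ((1 - b * q ^ s * x) * (1 - a / (b * q ^ s) * x))

/-- The nodes of `wellPoisedPoly` in the variable `a x + 1 / x`. -/
noncomputable def wellPoisedNode (q a b : ℂ) (s : ℕ) : ℂ := b * q ^ s + a / (b * q ^ s)

/-- Each pair satisfies `(1 - βx)(1 - (a/β)x) = x (ax + 1/x - β - a/β)`, so up to `x^j` the product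
is a Newton basis element in `ax + 1/x`. -/
theorem wellPoisedPoly_eq {q a b x : ℂ} (hq0 : q ≠ 0) (hb : b ≠ 0) (hx : x ≠ 0) (j : ℕ) :
    wellPoisedPoly q a b j x =
      x ^ j * ∏ s ∈ Finset.range j, (a * x + 1 / x - wellPoisedNode q a b s) := by
  have : x ^ j = ∏ s ∈ Finset.range j, x := by simp
  rw [this, ← Finset.prod_mul_distrib, wellPoisedPoly]
  refine Finset.prod_congr rfl fun s _ => ?_
  have := pow_ne_zero s hq0
  rw [wellPoisedNode]
  field_simp
  ring

/-- With `y = ax + 1/x` one has `y_j - y_i = (x_i - x_j)(1 - a x_i x_j)/(x_i x_j)`. The denominators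
multiply to `∏ x_i^{r-1}`, the powers taken out of the rows. -/
theorem det_wellPoisedPoly {q a b c : ℂ} (hq0 : q ≠ 0) (hb : b ≠ 0) (hc : c ≠ 0) {r : ℕ}
    (hβ : ∀ i < r, ∀ j < i, wellPoisedNode q a b i ≠ wellPoisedNode q a b j)
    (x : Fin r → ℂ) (hx : ∀ i, x i ≠ 0) :
    (Matrix.of fun i j : Fin r =>
      wellPoisedPoly q a b j (x i) * wellPoisedPoly q a c (r - 1 - j) (x i)).det =
    (∏ i ∈ Finset.range r, ∏ t ∈ Finset.range (r - 1 - i),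
      (wellPoisedNode q a b i - wellPoisedNode q a c t)) *
      ∏ i : Fin r, ∏ j ∈ Finset.Ioi i, ((x i - x j) * (1 - a * (x i * x j))) := by
  have h1 : (Matrix.of fun i j : Fin r =>
      wellPoisedPoly q a b j (x i) * wellPoisedPoly q a c (r - 1 - j) (x i)) =
      Matrix.of fun i j : Fin r => x i ^ (r - 1) *
        (Matrix.of fun i j : Fin r =>
          (∏ s ∈ Finset.range j, (a * x i + 1 / x i - wellPoisedNode q a b s)) *
          ∏ t ∈ Finset.range (r - 1 - j), (a * x i + 1 / x i - wellPoisedNode q a c t)) i j := by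
    ext i j
    have hj := j.isLt
    have : r - 1 = j + (r - 1 - j) := by lia
    rw [Matrix.of_apply, Matrix.of_apply, Matrix.of_apply, wellPoisedPoly_eq hq0 hb (hx i),
      wellPoisedPoly_eq hq0 hc (hx i), mul_mul_mul_comm, ← pow_add, ← this]
  rw [h1, Matrix.det_mul_column,
    det_two_newton_bases _ _ hβ (fun i => a * x i + 1 / x i), mul_left_comm, ← prod_pairs_mul,
    ← Finset.prod_mul_distrib]
  congr 1
  refine Finset.prod_congr rfl fun i _ => ?_
  rw [← Finset.prod_mul_distrib]
  refine Finset.prod_congr rfl fun j _ => ?_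
  have := hx i
  have := hx j
  field_simp
  ring

/-- Iterated contiguous shifts: passing from `b` to `b q^j` inserts a polynomial in `q^k`,
normalized to be `1` at `k = 0`. -/
theorem wellPoisedRatio_mul_pow {q a b : ℂ} (hq0 : q ≠ 0) (gb : NotQPower q b)
    (gab : NotQPower q (a / b)) (j k : ℕ) :
    wellPoisedRatio q a (b * q ^ j) k =
      wellPoisedRatio q a b k * (wellPoisedPoly q a b j (q ^ k) * (wellPoisedPoly q a b j 1)⁻¹) := by
  induction j with
  | zero => simp [wellPoisedPoly]
  | succ j ih =>
    have g1 : NotQPower q (a / (b * q ^ j)) := by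
      have := gab.mul_zpow hq0 (-j)
      rwa [zpow_neg, zpow_natCast, ← div_eq_mul_inv, div_div] at this
    have h := wellPoisedRatio_mul_shift (a := a) (b := b * q ^ j) (k := k) hq0
      (by rw [← div_mul_eq_mul_div]; exact (g1.mul_self hq0).qShiftedFactorial_ne_zero hq0 _)
      (g1.qShiftedFactorial_ne_zero hq0 _)
    have z1 := (gb.mul_pow hq0 j).one_sub_ne_zero
    have z2 := g1.one_sub_ne_zero
    rw [ih] at h
    have e : ∀ x, wellPoisedPoly q a b (j + 1) x = wellPoisedPoly q a b j x *
        ((1 - b * q ^ j * x) * (1 - a / (b * q ^ j) * x)) := fun x => by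
      rw [wellPoisedPoly, wellPoisedPoly, Finset.prod_range_succ]
    rw [e, e, pow_succ, ← mul_assoc, mul_one, mul_one]
    apply mul_right_cancel₀ (mul_ne_zero z1 z2)
    rw [← h, mul_inv]
    have hw := mul_ne_zero z1 z2
    generalize (1 - b * q ^ j) * (1 - a / (b * q ^ j)) = w at *
    field_simp

theorem wellPoisedPoly_one_ne_zero {q a b : ℂ} (hq0 : q ≠ 0) (gb : NotQPower q b)
    (gab : NotQPower q (a / b)) (j : ℕ) : wellPoisedPoly q a b j 1 ≠ 0 := by
  refine Finset.prod_ne_zero_iff.mpr fun s _ => ?_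
  rw [mul_one, mul_one]
  refine mul_ne_zero (gb.mul_pow hq0 s).one_sub_ne_zero ?_
  have := gab.mul_zpow hq0 (-s)
  rw [zpow_neg, zpow_natCast, ← div_eq_mul_inv, div_div] at this
  exact this.one_sub_ne_zero

/-! ### The multivariable series as a determinant -/

/-- The term of the multivariable series attached to a multi-index `k`. -/
noncomputable def multiTerm (q a b c d : ℂ) {r : ℕ} (e f g : Fin r → ℂ) (n k : Fin r → ℕ) : ℂ :=
  (∏ i : Fin r, ∏ j ∈ Finset.Ioi i, (q ^ k i - q ^ k j) * (1 - a * q ^ (k i + k j))) *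
    ∏ i : Fin r, baileyTerm q a b c d (e i) (f i) (g i) (n i) (k i)

/-- The multivariable terminating `₁₀φ₉` series of type `C_r`. -/
noncomputable def multiSum (q a b c d : ℂ) {r : ℕ} (e f g : Fin r → ℂ) (n : Fin r → ℕ) : ℂ :=
  ∑ k ∈ Fintype.piFinset (fun i => Finset.range (n i + 1)), multiTerm q a b c d e f g n k

/-- The proportionality factor between the determinant of `wellPoisedPoly` products and the type
`C` Vandermonde product. -/
noncomputable def nodeFactor (q a b c : ℂ) (r : ℕ) : ℂ :=
  ∏ i ∈ Finset.range r, ∏ t ∈ Finset.range (r - 1 - i),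
    (wellPoisedNode q a b i - wellPoisedNode q a c t)

/-- The value at `1` of the product of the `r` polynomials used in the determinant. -/
noncomputable def polyNormalization (q a b c : ℂ) (r : ℕ) : ℂ :=
  ∏ j ∈ Finset.range r, (wellPoisedPoly q a b j 1 * wellPoisedPoly q a c (r - 1 - j) 1)

theorem det_sum_rows {R ι : Type*} [CommRing R] {r : ℕ} (A : Fin r → Finset ι)
    (w : Fin r → ι → Fin r → R) :
    (Matrix.of fun i j : Fin r => ∑ k ∈ A i, w i k j).det =
      ∑ k ∈ Fintype.piFinset A, (Matrix.of fun i j : Fin r => w i (k i) j).det := by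
  have := (Matrix.detRowAlternating (n := Fin r) (R := R)).toMultilinearMap.map_sum_finset w A
  simp only [AlternatingMap.coe_multilinearMap] at this
  convert this using 2
  · refine congrArg Matrix.det ?_
    ext i j
    simp
  · rfl

/-- Written as a determinant, the product over pairs has row `i` depending only on `k_i`, so the
one-variable summands can be absorbed into the rows and the summations carried inside. -/
theorem nodeFactor_mul_multiSum {q a b c d : ℂ} (hq0 : q ≠ 0) (hb : b ≠ 0) (hc : c ≠ 0) {r : ℕ}
    (e f g : Fin r → ℂ) (n : Fin r → ℕ)
    (hβ : ∀ i < r, ∀ j < i, wellPoisedNode q a b i ≠ wellPoisedNode q a b j)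
    (gb : NotQPower q b) (gc : NotQPower q c) (gab : NotQPower q (a / b))
    (gac : NotQPower q (a / c)) :
    nodeFactor q a b c r * multiSum q a b c d e f g n = polyNormalization q a b c r *
      (Matrix.of fun i j : Fin r => ∑ k ∈ Finset.range (n i + 1),
        baileyTerm q a (b * q ^ (j : ℕ)) (c * q ^ (r - 1 - j)) d (e i) (f i) (g i) (n i) k).det := by
  rw [det_sum_rows, multiSum, Finset.mul_sum, Finset.mul_sum]
  refine Finset.sum_congr rfl fun k _ => ?_
  have h1 : (Matrix.of fun i j : Fin r =>
      baileyTerm q a (b * q ^ (j : ℕ)) (c * q ^ (r - 1 - j)) d (e i) (f i) (g i) (n i) (k i)) =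
      Matrix.of fun i j : Fin r => baileyTerm q a b c d (e i) (f i) (g i) (n i) (k i) *
        (Matrix.of fun i j : Fin r =>
          (wellPoisedPoly q a b j 1 * wellPoisedPoly q a c (r - 1 - j) 1)⁻¹ *
          (Matrix.of fun i j : Fin r => wellPoisedPoly q a b j (q ^ k i) *
            wellPoisedPoly q a c (r - 1 - j) (q ^ k i)) i j) i j := by
    ext i j
    simp only [Matrix.of_apply, baileyTerm, wellPoisedRatio_mul_pow hq0 gb gab,
      wellPoisedRatio_mul_pow hq0 gc gac, mul_inv]
    ring
  rw [h1, Matrix.det_mul_column, Matrix.det_mul_row,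
    det_wellPoisedPoly hq0 hb hc hβ _ fun i => pow_ne_zero _ hq0, Finset.prod_inv_distrib,
    Fin.prod_univ_eq_prod_range
      (fun j => wellPoisedPoly q a b j 1 * wellPoisedPoly q a c (r - 1 - j) 1) r]
  have h2 : polyNormalization q a b c r ≠ 0 := Finset.prod_ne_zero_iff.mpr fun j _ =>
    mul_ne_zero (wellPoisedPoly_one_ne_zero hq0 gb gab _)
      (wellPoisedPoly_one_ne_zero hq0 gc gac _)
  change _ = polyNormalization q a b c r * (_ * ((polyNormalization q a b c r)⁻¹ *
    (nodeFactor q a b c r * _)))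
  simp only [multiTerm, pow_add]
  rw [mul_left_comm _ (polyNormalization q a b c r)⁻¹, mul_inv_cancel_left₀ h2]
  ring

/-- A node difference factors as `(b q^i - c q^t)(1 - a q^{-i-t}/(bc))`. Here `d` is an auxiliary
parameter equal to `a q^{2-r}/(bc)`: it is `dλ/a` for the original series and `d` for the
transformed one. -/
theorem nodeFactor_eq {q a b c d : ℂ} (hq0 : q ≠ 0) (hb : b ≠ 0) (hc : c ≠ 0) {r : ℕ}
    (hd : d * b * c * q ^ r = a * q ^ 2) :
    nodeFactor q a b c r =
      (∏ i ∈ Finset.range r, ∏ t ∈ Finset.range (r - 1 - i), (b * q ^ i - c * q ^ t)) *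
        ∏ i ∈ Finset.range r, qShiftedFactorial q d i := by
  have h1 : ∏ i ∈ Finset.range r, qShiftedFactorial q d i =
      ∏ i ∈ Finset.range r, qShiftedFactorial q d (r - 1 - i) :=
    (Finset.prod_range_reflect _ _).symm
  rw [h1, ← Finset.prod_mul_distrib, nodeFactor]
  refine Finset.prod_congr rfl fun i hi => ?_
  have hi := Finset.mem_range.mp hi
  have h2 : qShiftedFactorial q d (r - 1 - i) =
      ∏ t ∈ Finset.range (r - 1 - i), (1 - d * q ^ (r - 1 - i - 1 - t)) :=
    (Finset.prod_range_reflect (fun t => 1 - d * q ^ t) _).symm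
  rw [h2, ← Finset.prod_mul_distrib]
  refine Finset.prod_congr rfl fun t ht => ?_
  have ht := Finset.mem_range.mp ht
  -- The exponent `r - 2 - i - t` of `q` is nonnegative because `t < r - 1 - i`.
  obtain ⟨m, hm⟩ : ∃ m, r = m + i + t + 2 := ⟨r - i - t - 2, by lia⟩
  have hm' : r - 1 - i - 1 - t = m := by lia
  rw [hm']
  have ha : a = d * b * c * q ^ m * q ^ i * q ^ t := by
    apply mul_right_cancel₀ (pow_ne_zero 2 hq0)
    rw [← hd, hm]
    ring
  have := pow_ne_zero i hq0
  have := pow_ne_zero t hq0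
  rw [wellPoisedNode, wellPoisedNode, ha]
  field_simp
  ring

theorem polyNormalization_eq (q a b c : ℂ) (r : ℕ) :
    polyNormalization q a b c r =
      (∏ i ∈ Finset.range r, qShiftedFactorial q b i) *
      (∏ i ∈ Finset.range r, qShiftedFactorial q c i) *
      ((∏ j ∈ Finset.range r, ∏ s ∈ Finset.range j, (1 - a / b / q ^ s)) *
        ∏ j ∈ Finset.range r, ∏ s ∈ Finset.range j, (1 - a / c / q ^ s)) := by
  have h : ∀ b j, wellPoisedPoly q a b j 1 =
      qShiftedFactorial q b j * ∏ s ∈ Finset.range j, (1 - a / b / q ^ s) := fun b j => by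
    simp only [wellPoisedPoly, Finset.prod_mul_distrib, mul_one, div_div, qShiftedFactorial]
  rw [polyNormalization, Finset.prod_mul_distrib,
    Finset.prod_range_reflect (fun j => wellPoisedPoly q a c j 1) r]
  simp only [h, Finset.prod_mul_distrib]
  ring

theorem sum_range_tsub (r : ℕ) : ∑ i ∈ Finset.range r, (r - 1 - i) = r.choose 2 := by
  rw [Finset.sum_range_reflect (fun i => i) r, Finset.sum_range_id, Nat.choose_two_right]

/-- The parts of the normalizations involving `a/b` and `a/c` are unchanged by `(a,b,c) → (λ, λb/a,
λc/a)` and cancel. The `d` factors come from the node differences, and scaling `b q^i - c q^t` by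
`λ/a` gives the binomial power. -/
theorem multi_constant {q a b c d lam : ℂ} (hq0 : q ≠ 0) (ha : a ≠ 0) (hb : b ≠ 0)
    (hc : c ≠ 0) (hl : lam ≠ 0) {r : ℕ}
    (hlam : lam * (b * c * d) * q ^ r = a ^ 2 * q ^ 2) :
    polyNormalization q a b c r * nodeFactor q lam (lam * b / a) (lam * c / a) r *
      ((∏ i ∈ Finset.range r, qShiftedFactorial q (b * lam / a) i) *
        (∏ i ∈ Finset.range r, qShiftedFactorial q (c * lam / a) i) *
        ∏ i ∈ Finset.range r, qShiftedFactorial q (d * lam / a) i) =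
    (lam / a) ^ (r.choose 2) *
      ((∏ i ∈ Finset.range r, qShiftedFactorial q b i) *
        (∏ i ∈ Finset.range r, qShiftedFactorial q c i) *
        ∏ i ∈ Finset.range r, qShiftedFactorial q d i) *
      (polyNormalization q lam (lam * b / a) (lam * c / a) r * nodeFactor q a b c r) := by
  rw [nodeFactor_eq (d := d * lam / a) hq0 hb hc (by field_simp; linear_combination hlam),
    nodeFactor_eq (d := d) hq0 (by simp [*]) (by simp [*])
      (by field_simp; linear_combination hlam),
    polyNormalization_eq, polyNormalization_eq]
  have e : ∀ y, lam / (lam * y / a) = a / y := fun y => by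
    by_cases hy : y = 0
    · simp [hy]
    · field_simp
  have h : (∏ i ∈ Finset.range r, ∏ t ∈ Finset.range (r - 1 - i),
      (lam * b / a * q ^ i - lam * c / a * q ^ t)) = (lam / a) ^ (r.choose 2) *
      ∏ i ∈ Finset.range r, ∏ t ∈ Finset.range (r - 1 - i), (b * q ^ i - c * q ^ t) := by
    rw [← sum_range_tsub, ← Finset.prod_pow_eq_pow_sum, ← Finset.prod_mul_distrib]
    refine Finset.prod_congr rfl fun i _ => ?_
    have h1 : (lam / a) ^ (r - 1 - i) = ∏ t ∈ Finset.range (r - 1 - i), lam / a := by simp [div_pow]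
    rw [h1, ← Finset.prod_mul_distrib]
    exact Finset.prod_congr rfl fun t _ => by ring
  rw [h, e, e, mul_comm lam b, mul_comm lam c]
  ring

/-- The multivariable transformation for generic `b`, `c`, `d`. -/
theorem multiSum_transformation_generic {q : ℂ} (hq0 : q ≠ 0) (hq1 : ‖q‖ < 1)
    {a b c d lam : ℂ} {r : ℕ} {e f g : Fin r → ℂ} {n : Fin r → ℕ}
    (ha : a ≠ 0) (hb : b ≠ 0) (hc : c ≠ 0) (hd : d ≠ 0) (hl : lam ≠ 0)
    (he : ∀ i, e i ≠ 0) (hf : ∀ i, f i ≠ 0) (hg : ∀ i, g i ≠ 0)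
    (hlam : lam * (b * c * d) * q ^ r = a ^ 2 * q ^ 2)
    (hbal : ∀ i, e i * f i * g i = a * lam * q ^ (n i + 1))
    (ha1 : a ≠ 1) (hl1 : lam ≠ 1)
    (ze : ∀ i, qShiftedFactorial q (a * q / e i) (n i) ≠ 0)
    (zf : ∀ i, qShiftedFactorial q (a * q / f i) (n i) ≠ 0)
    (zg : ∀ i, qShiftedFactorial q (a * q / g i) (n i) ≠ 0)
    (zn : ∀ i, qShiftedFactorial q (a * q ^ (1 + n i)) (n i) ≠ 0)
    (ye : ∀ i, qShiftedFactorial q (lam * q / e i) (n i) ≠ 0)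
    (yf : ∀ i, qShiftedFactorial q (lam * q / f i) (n i) ≠ 0)
    (yg : ∀ i, qShiftedFactorial q (lam * q / g i) (n i) ≠ 0)
    (yn : ∀ i, qShiftedFactorial q (lam * q ^ (1 + n i)) (n i) ≠ 0)
    (yl : ∀ i, qShiftedFactorial q (lam * q) (n i) ≠ 0)
    (yef : ∀ i, qShiftedFactorial q (lam * q / (e i * f i)) (n i) ≠ 0)
    (gb : NotQPower q b) (gc : NotQPower q c) (gab : NotQPower q (a / b))
    (gac : NotQPower q (a / c)) (gad : NotQPower q (a / d))
    (glb : NotQPower q (lam * b / a)) (glc : NotQPower q (lam * c / a))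
    (gld : NotQPower q (d * lam / a)) (gcb : NotQPower q (c / b))
    (gbb : NotQPower q (a / b ^ 2)) (glbb : NotQPower q (lam / (lam * b / a) ^ 2)) :
    multiSum q a b c d e f g n =
      (lam / a) ^ (r.choose 2) *
      (((∏ i ∈ Finset.range r, qShiftedFactorial q b i) *
        (∏ i ∈ Finset.range r, qShiftedFactorial q c i) *
        ∏ i ∈ Finset.range r, qShiftedFactorial q d i) /
      ((∏ i ∈ Finset.range r, qShiftedFactorial q (b * lam / a) i) *
        (∏ i ∈ Finset.range r, qShiftedFactorial q (c * lam / a) i) *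
        ∏ i ∈ Finset.range r, qShiftedFactorial q (d * lam / a) i)) *
      (∏ i : Fin r, baileyFactor q a lam (e i) (f i) (n i)) *
      multiSum q lam (lam * b / a) (lam * c / a) (lam * d / a) e f g n := by
  -- Nodes `i` and `j` coincide only if `q^i = q^j` or `x = y² q^{i+j}`.
  have nodes : ∀ {x y : ℂ}, y ≠ 0 → NotQPower q (x / y ^ 2) → ∀ i < r, ∀ j < i,
      wellPoisedNode q x y i ≠ wellPoisedNode q x y j := by
    intro x y hy hg i _ j hji h
    have h1 : (y * q ^ i - y * q ^ j) * (1 - x / y ^ 2 * (q ^ (i + j))⁻¹) = 0 := by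
      have := pow_ne_zero i hq0
      have := pow_ne_zero j hq0
      rw [wellPoisedNode, wellPoisedNode, ← sub_eq_zero] at h
      rw [← h, pow_add]
      field_simp
      ring
    rcases mul_eq_zero.mp h1 with h2 | h2
    · obtain ⟨m, rfl⟩ : ∃ m, i = j + (m + 1) := ⟨i - j - 1, by lia⟩
      have h3 : y * q ^ j * (1 - q ^ (m + 1)) = 0 := by
        rw [pow_add] at h2; linear_combination -h2
      exact mul_ne_zero (mul_ne_zero hy (pow_ne_zero _ hq0))
        (one_sub_pow_ne_zero hq1 m.succ_ne_zero) h3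
    · have := hg.mul_zpow hq0 (-(i + j : ℕ))
      rw [zpow_neg, zpow_natCast] at this
      exact this.one_sub_ne_zero h2
  have hquot : ∀ {y : ℂ}, y ≠ 0 → lam / (lam * y / a) = a / y := fun hy => by field_simp
  have zpow_shift : ∀ {y : ℂ} (j m : ℕ), NotQPower q (a / y) →
      qShiftedFactorial q (a * q / (y * q ^ j)) m ≠ 0 := by
    intro y j m h
    have h1 := ((h.mul_zpow hq0 (-j)).mul_self hq0).qShiftedFactorial_ne_zero hq0 m
    rw [zpow_neg, zpow_natCast] at h1
    convert h1 using 2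
    rw [← div_eq_mul_inv, div_div, div_mul_eq_mul_div]
  have hA := nodeFactor_mul_multiSum (d := d) hq0 hb hc e f g n (nodes hb gbb) gb gc gab gac
  have hL := nodeFactor_mul_multiSum (d := lam * d / a) hq0 (by simp [*]) (by simp [*]) e f g n
    (nodes (by simp [*]) glbb) glb glc (by rwa [hquot hb]) (by rwa [hquot hc])
  -- The column shifts multiply `bc` by `q^{r-1}` whatever `j` is, so one `λ` serves all entries;
  -- `baileyFactor` depends only on `i` and comes out of each row.
  have hdet : (Matrix.of fun i j : Fin r => ∑ k ∈ Finset.range (n i + 1),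
        baileyTerm q a (b * q ^ (j : ℕ)) (c * q ^ (r - 1 - j)) d (e i) (f i) (g i) (n i) k).det =
      (∏ i, baileyFactor q a lam (e i) (f i) (n i)) * (Matrix.of fun i j : Fin r => ∑ k ∈ Finset.range (n i + 1),
        baileyTerm q lam (lam * b / a * q ^ (j : ℕ)) (lam * c / a * q ^ (r - 1 - j)) (lam * d / a)
          (e i) (f i) (g i) (n i) k).det := by
    rw [← Matrix.det_mul_column]
    congr 1
    ext i j
    have hj := j.isLt
    simp only [Matrix.of_apply]
    have hrj : q ^ r = q ^ (j : ℕ) * q ^ (r - 1 - j) * q := by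
      rw [← pow_add, ← pow_succ]; congr 1; lia
    rw [bailey_transformation (lam := lam) hq0 hq1 ha (by simp [*]) (by simp [*]) hd (he i) (hf i)
      (hg i) hl
      (by
        apply mul_right_cancel₀ hq0
        rw [hrj] at hlam
        linear_combination hlam) (hbal i) ha1 hl1 (zpow_shift _ _ gab) (zpow_shift _ _ gac)
      (by simpa using zpow_shift 0 (n i) gad) (ze i) (zf i) (zg i) (zn i) (ye i) (yf i) (yg i)
      (yn i) (yl i) (yef i)]
    have e1 : ∀ y z : ℂ, lam * (y * z) / a = lam * y / a * z := fun y z => by ring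
    rw [e1, e1]
  have hconst := multi_constant hq0 ha hb hc hl hlam
  have hprod : ∀ {y : ℂ}, NotQPower q y → ∏ i ∈ Finset.range r, qShiftedFactorial q y i ≠ 0 :=
    fun h => Finset.prod_ne_zero_iff.mpr fun i _ => h.qShiftedFactorial_ne_zero hq0 i
  have hden : (∏ i ∈ Finset.range r, qShiftedFactorial q (b * lam / a) i) *
        (∏ i ∈ Finset.range r, qShiftedFactorial q (c * lam / a) i) *
        ∏ i ∈ Finset.range r, qShiftedFactorial q (d * lam / a) i ≠ 0 :=
    mul_ne_zero (mul_ne_zero (hprod (by rwa [mul_comm b])) (hprod (by rwa [mul_comm c])))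
      (hprod gld)
  have hnode : nodeFactor q a b c r ≠ 0 := by
    rw [nodeFactor_eq (d := d * lam / a) hq0 hb hc (by field_simp; linear_combination hlam)]
    refine mul_ne_zero ?_ (hprod gld)
    refine Finset.prod_ne_zero_iff.mpr fun i _ => Finset.prod_ne_zero_iff.mpr fun t _ h => ?_
    refine gcb ((i : ℤ) - t) ?_
    have := pow_ne_zero t hq0
    rw [zpow_sub₀ hq0, zpow_natCast, zpow_natCast]
    field_simp
    linear_combination -h
  have hnorm : polyNormalization q lam (lam * b / a) (lam * c / a) r ≠ 0 :=
    Finset.prod_ne_zero_iff.mpr fun j _ =>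
      mul_ne_zero (wellPoisedPoly_one_ne_zero hq0 glb (by rwa [hquot hb]) _)
        (wellPoisedPoly_one_ne_zero hq0 glc (by rwa [hquot hc]) _)
  rw [hdet] at hA
  apply mul_left_cancel₀ (mul_ne_zero hnode (mul_ne_zero hden hnorm))
  generalize (Matrix.of fun i j : Fin r => ∑ k ∈ Finset.range (n i + 1),
        baileyTerm q lam (lam * b / a * q ^ (j : ℕ)) (lam * c / a * q ^ (r - 1 - j)) (lam * d / a)
          (e i) (f i) (g i) (n i) k).det = D at *
  generalize multiSum q a b c d e f g n = S at *
  generalize multiSum q lam (lam * b / a) (lam * c / a) (lam * d / a) e f g n = T at *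
  generalize (∏ i ∈ Finset.range r, qShiftedFactorial q (b * lam / a) i) *
        (∏ i ∈ Finset.range r, qShiftedFactorial q (c * lam / a) i) *
        ∏ i ∈ Finset.range r, qShiftedFactorial q (d * lam / a) i = Y at *
  generalize (∏ i ∈ Finset.range r, qShiftedFactorial q b i) *
        (∏ i ∈ Finset.range r, qShiftedFactorial q c i) *
        ∏ i ∈ Finset.range r, qShiftedFactorial q d i = X at *
  generalize polyNormalization q lam (lam * b / a) (lam * c / a) r = Pl at *
  generalize polyNormalization q a b c r = P at *
  generalize nodeFactor q lam (lam * b / a) (lam * c / a) r = Kl at *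
  generalize nodeFactor q a b c r = K at *
  generalize (lam / a) ^ (r.choose 2) = w at *
  generalize ∏ i, baileyFactor q a lam (e i) (f i) (n i) = Q at *
  have h1 : K * (Y * Pl) * (w * (X / Y) * Q * T) = K * Pl * w * X * Q * T := by field_simp
  rw [h1]
  linear_combination Y * Pl * hA - Y * P * Q * hL + Q * T * hconst

/-! ### The multivariable transformation without genericity -/

theorem ContinuousAt.multiSum {X : Type*} [TopologicalSpace X] {a b c d : X → ℂ} {t : X} {r : ℕ}
    {e f g : Fin r → ℂ} {n : Fin r → ℕ}
    {q : ℂ} (hq0 : q ≠ 0) (hq1 : ‖q‖ < 1)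
    (ha : ContinuousAt a t) (hb : ContinuousAt b t) (hc : ContinuousAt c t)
    (hd : ContinuousAt d t) (a0 : a t ≠ 0) (a1 : a t ≠ 1)
    (b0 : b t ≠ 0) (c0 : c t ≠ 0) (d0 : d t ≠ 0)
    (e0 : ∀ i, e i ≠ 0) (f0 : ∀ i, f i ≠ 0) (g0 : ∀ i, g i ≠ 0)
    (zb : ∀ i, _root_.qShiftedFactorial q (a t * q / b t) (n i) ≠ 0)
    (zc : ∀ i, _root_.qShiftedFactorial q (a t * q / c t) (n i) ≠ 0)
    (zd : ∀ i, _root_.qShiftedFactorial q (a t * q / d t) (n i) ≠ 0)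
    (ze : ∀ i, _root_.qShiftedFactorial q (a t * q / e i) (n i) ≠ 0)
    (zf : ∀ i, _root_.qShiftedFactorial q (a t * q / f i) (n i) ≠ 0)
    (zg : ∀ i, _root_.qShiftedFactorial q (a t * q / g i) (n i) ≠ 0)
    (zn : ∀ i, _root_.qShiftedFactorial q (a t * q ^ (1 + n i)) (n i) ≠ 0) :
    ContinuousAt (fun s => _root_.multiSum q (a s) (b s) (c s) (d s) e f g n) t := by
  refine tendsto_finsetSum _ fun k hk => ?_
  refine ContinuousAt.mul ?_ ?_
  · refine tendsto_finsetProd _ fun i _ => tendsto_finsetProd _ fun j _ => ?_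
    exact continuousAt_const.mul (continuousAt_const.sub (ha.mul continuousAt_const))
  · refine tendsto_finsetProd _ fun i _ => ?_
    have hki := Nat.lt_succ_iff.mp (Finset.mem_range.mp (Fintype.mem_piFinset.mp hk i))
    exact ContinuousAt.baileyTerm hq0 hq1 hki ha hb hc hd continuousAt_const continuousAt_const
      continuousAt_const a0 a1 b0 c0 d0 (e0 i) (f0 i) (g0 i) (zb i) (zc i) (zd i) (ze i) (zf i)
      (zg i) (zn i)

/-- The `C_r` transformation between the multivariable series. -/
theorem multiSum_transformation {q : ℂ} (hq0 : q ≠ 0) (hq1 : ‖q‖ < 1)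
    {a b c d lam : ℂ} {r : ℕ} {e f g : Fin r → ℂ} {n : Fin r → ℕ}
    (ha : a ≠ 0) (hb : b ≠ 0) (hc : c ≠ 0) (hd : d ≠ 0) (hl : lam ≠ 0)
    (he : ∀ i, e i ≠ 0) (hf : ∀ i, f i ≠ 0) (hg : ∀ i, g i ≠ 0)
    (hlam : lam * (b * c * d) * q ^ r = a ^ 2 * q ^ 2)
    (hbal : ∀ i, e i * f i * g i = a * lam * q ^ (n i + 1))
    (ha1 : a ≠ 1) (hl1 : lam ≠ 1)
    (zb : ∀ i, qShiftedFactorial q (a * q / b) (n i) ≠ 0)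
    (zc : ∀ i, qShiftedFactorial q (a * q / c) (n i) ≠ 0)
    (zd : ∀ i, qShiftedFactorial q (a * q / d) (n i) ≠ 0)
    (ze : ∀ i, qShiftedFactorial q (a * q / e i) (n i) ≠ 0)
    (zf : ∀ i, qShiftedFactorial q (a * q / f i) (n i) ≠ 0)
    (zg : ∀ i, qShiftedFactorial q (a * q / g i) (n i) ≠ 0)
    (zn : ∀ i, qShiftedFactorial q (a * q ^ (1 + n i)) (n i) ≠ 0)
    (ye : ∀ i, qShiftedFactorial q (lam * q / e i) (n i) ≠ 0)
    (yf : ∀ i, qShiftedFactorial q (lam * q / f i) (n i) ≠ 0)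
    (yg : ∀ i, qShiftedFactorial q (lam * q / g i) (n i) ≠ 0)
    (yn : ∀ i, qShiftedFactorial q (lam * q ^ (1 + n i)) (n i) ≠ 0)
    (yl : ∀ i, qShiftedFactorial q (lam * q) (n i) ≠ 0)
    (yef : ∀ i, qShiftedFactorial q (lam * q / (e i * f i)) (n i) ≠ 0)
    (xb : qShiftedFactorial q (b * lam / a) (r - 1) ≠ 0)
    (xc : qShiftedFactorial q (c * lam / a) (r - 1) ≠ 0)
    (xd : qShiftedFactorial q (d * lam / a) (r - 1) ≠ 0) :
    multiSum q a b c d e f g n =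
      (lam / a) ^ (r.choose 2) *
      (((∏ i ∈ Finset.range r, qShiftedFactorial q b i) *
        (∏ i ∈ Finset.range r, qShiftedFactorial q c i) *
        ∏ i ∈ Finset.range r, qShiftedFactorial q d i) /
      ((∏ i ∈ Finset.range r, qShiftedFactorial q (b * lam / a) i) *
        (∏ i ∈ Finset.range r, qShiftedFactorial q (c * lam / a) i) *
        ∏ i ∈ Finset.range r, qShiftedFactorial q (d * lam / a) i)) *
      (∏ i : Fin r, baileyFactor q a lam (e i) (f i) (n i)) *
      multiSum q lam (lam * b / a) (lam * c / a) (lam * d / a) e f g n := by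
  -- The deformation `b t`, `c t²`, `d t⁻³` fixes `bcd`, hence `λ` and the balancing conditions; the
  -- distinct exponents for `b` and `c` also make `c/b` generic.
  have cB : ContinuousAt (fun t : ℂ => b * t) 1 := by fun_prop
  have cC : ContinuousAt (fun t : ℂ => c * t ^ 2) 1 := by fun_prop
  have cD : ContinuousAt (fun t : ℂ => d / t ^ 3) 1 :=
    continuousAt_const.div (by fun_prop) (by simp)
  have cquot : ∀ {y : ℂ → ℂ}, ContinuousAt y 1 → ContinuousAt (fun t : ℂ => lam * y t / a) 1 :=
    fun h => (continuousAt_const.mul h).div_const a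
  have cancel : ∀ y : ℂ, y ≠ 0 → lam * q / (lam * y / a) = a * q / y := fun y hy => by field_simp
  have hprod : ∀ {y : ℂ}, qShiftedFactorial q y (r - 1) ≠ 0 →
      ∏ i ∈ Finset.range r, qShiftedFactorial q y i ≠ 0 := fun h =>
    Finset.prod_ne_zero_iff.mpr fun i hi =>
      qShiftedFactorial_ne_zero_of_le h (by have := Finset.mem_range.mp hi; lia)
  have cprod : ∀ {y : ℂ → ℂ}, ContinuousAt y 1 →
      ContinuousAt (fun t => ∏ i ∈ Finset.range r, qShiftedFactorial q (y t) i) 1 := fun h =>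
    tendsto_finsetProd _ fun i _ => h.qShiftedFactorial q i
  have hF : ContinuousAt (fun t : ℂ => multiSum q a (b * t) (c * t ^ 2) (d / t ^ 3) e f g n) 1 :=
    ContinuousAt.multiSum hq0 hq1 continuousAt_const cB cC cD ha ha1 (by simpa) (by simpa)
      (by simpa) he hf hg (by simpa) (by simpa) (by simpa) ze zf zg zn
  have hG : ContinuousAt (fun t : ℂ => multiSum q lam (lam * (b * t) / a) (lam * (c * t ^ 2) / a)
      (lam * (d / t ^ 3) / a) e f g n) 1 :=
    ContinuousAt.multiSum hq0 hq1 continuousAt_const (cquot cB) (cquot cC) (cquot cD) hl hl1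
      (by simp [*]) (by simp [*]) (by simp [*]) he hf hg (by simpa [cancel b hb])
      (by simpa [cancel c hc]) (by simpa [cancel d hd]) ye yf yg yn
  have cmul : ∀ {y : ℂ → ℂ}, ContinuousAt y 1 → ContinuousAt (fun t : ℂ => y t * lam / a) 1 :=
    fun h => (h.mul continuousAt_const).div_const a
  have hN := ((cprod cB).mul (cprod cC)).mul (cprod cD)
  have hY := ((cprod (cmul cB)).mul (cprod (cmul cC))).mul (cprod (cmul cD))
  have hQ := hN.div hY (by
    simpa using ⟨⟨hprod xb, hprod xc⟩, hprod xd⟩)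
  have := eq_of_ae_eq_of_continuousAt hF
    ((((continuousAt_const (y := (lam / a) ^ (r.choose 2))).mul hQ).mul
      (continuousAt_const (y := ∏ i : Fin r, baileyFactor q a lam (e i) (f i) (n i)))).mul hG) ?_
  · simpa using this
  have gen : ∀ {u : ℂ} (_ : u ≠ 0) {N : ℕ} (_ : N ≠ 0), ∀ᵐ t : ℂ, NotQPower q (u * t ^ N) :=
    fun hu _ hN => ae_notQPower q hu hN
  have hla := div_ne_zero hl ha
  filter_upwards [ae_ne_zero_complex, gen hb one_ne_zero, gen hc two_ne_zero,
    gen (div_ne_zero hb ha) one_ne_zero, gen (div_ne_zero hc ha) two_ne_zero,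
    gen (div_ne_zero ha hd) three_ne_zero, gen (mul_ne_zero hla hb) one_ne_zero,
    gen (mul_ne_zero hla hc) two_ne_zero, gen (inv_ne_zero (mul_ne_zero hla hd)) three_ne_zero,
    gen (div_ne_zero hc hb) one_ne_zero, gen (div_ne_zero (pow_ne_zero 2 hb) ha) two_ne_zero,
    gen (div_ne_zero (mul_ne_zero hl (pow_ne_zero 2 hb)) (pow_ne_zero 2 ha)) two_ne_zero]
    with t t0 k1 k2 k3 k4 k5 k6 k7 k8 k9 k10 k11
  have := multiSum_transformation_generic (b := b * t) (c := c * t ^ 2) (d := d / t ^ 3) hq0 hq1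
    ha (by simp [*]) (by simp [*]) (by simp [*]) hl he hf hg
    (by field_simp; linear_combination hlam) hbal ha1 hl1 ze zf zg zn ye yf yg yn yl yef
    (by simpa using k1) k2 (by convert k3.inv using 1; field_simp)
    (by convert k4.inv using 1; field_simp) (by convert k5 using 1; field_simp)
    (by convert k6 using 1; field_simp)
    (by convert k7 using 1; field_simp) (by convert k8.inv using 1; field_simp)
    (by convert k9 using 1; field_simp) (by convert k10.inv using 1; field_simp)
    (by convert k11.inv using 1; field_simp)
  exact this

/-! ### Passage to the stated form -/

theorem baileyTerm_eq {q a b c d e f g : ℂ} (ha : a ≠ 0) (n k : ℕ) :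
    (1 - a * q ^ (2 * k)) *
        qShiftedFactorials q [a, b, c, d, e, f, g, q ^ (-(n : ℤ))] k /
      ((1 - a) *
        qShiftedFactorials q [q, a * q / b, a * q / c, a * q / d, a * q / e, a * q / f, a * q / g,
          a * q ^ (1 + n)] k) * q ^ k = baileyTerm q a b c d e f g n k := by
  have h1 : a * q ^ (1 + n) = a * q / (q ^ n)⁻¹ := by rw [div_inv_eq_mul]; ring
  have h2 : a * q / a = q := mul_div_cancel_left₀ _ ha
  simp only [qShiftedFactorials, List.map_cons, List.map_nil, List.prod_cons, List.prod_nil,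
    baileyTerm, wellPoisedRatio, zpow_neg, zpow_natCast, h1, h2, mul_one, div_eq_mul_inv, mul_inv]
  ac_rfl

/-- The very-well-poised part collapses: `(qs,-qs)_k/(s,-s)_k = (1 - a q^{2k})/(1 - a)` by shifting
each factorial, and `q^{-n}` truncates the series. -/
theorem basicHypergeometric_eq_sum_baileyTerm {q a b c d e f g s : ℂ} (hq0 : q ≠ 0) (ha : a ≠ 0)
    (ha1 : a ≠ 1) (hs : s ^ 2 = a) {n : ℕ} (h1 : qShiftedFactorial q s n ≠ 0)
    (h2 : qShiftedFactorial q (-s) n ≠ 0) :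
    basicHypergeometric
        [a, q * s, -(q * s), b, c, d, e, f, g, q ^ (-(n : ℤ))]
        [s, -s, a * q / b, a * q / c, a * q / d, a * q / e, a * q / f, a * q / g,
          a * q ^ (1 + n)] q q =
      ∑ k ∈ Finset.range (n + 1), baileyTerm q a b c d e f g n k := by
  rw [basicHypergeometric, tsum_eq_sum (s := Finset.range (n + 1))]
  · refine Finset.sum_congr rfl fun k hk => ?_
    have hk := Nat.lt_succ_iff.mp (Finset.mem_range.mp hk)
    have z1 := qShiftedFactorial_ne_zero_of_le h1 hk
    have z2 := qShiftedFactorial_ne_zero_of_le h2 hk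
    have e1 := qShiftedFactorial_mul_shift q s k
    have e2 := qShiftedFactorial_mul_shift q (-s) k
    have z3 : 1 - a ≠ 0 := sub_ne_zero.mpr ha1.symm
    have key : qShiftedFactorial q (q * s) k * qShiftedFactorial q (-(q * s)) k /
        (qShiftedFactorial q s k * qShiftedFactorial q (-s) k) =
        (1 - a * q ^ (2 * k)) / (1 - a) := by
      rw [div_eq_div_iff (mul_ne_zero z1 z2) z3, mul_comm q s, ← neg_mul, ← hs, mul_comm 2 k,
        pow_mul]
      linear_combination -(1 + s) * qShiftedFactorial q (-s * q) k * e1 -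
        qShiftedFactorial q s k * (1 - s * q ^ k) * e2
    rw [← baileyTerm_eq ha, mul_div_mul_comm (1 - a * q ^ (2 * k)), ← key]
    simp only [qShiftedFactorials, List.map_cons, List.map_nil, List.prod_cons, List.prod_nil,
      div_eq_mul_inv, mul_inv]
    ac_rfl
  · intro k hk
    have hk : n < k := by simpa using hk
    simp [qShiftedFactorials, qShiftedFactorial_inv_pow_eq_zero hq0 hk]

theorem basicHypergeometric_of_zero_pow (q z : ℂ) (as bs : List ℂ) :
    basicHypergeometric (as ++ [q ^ (-((0 : ℕ) : ℤ))]) bs q z = 1 := by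
  have h0 : ∀ l : List ℂ, qShiftedFactorials q l 0 = 1 := fun l => by
    simp [qShiftedFactorials, qShiftedFactorial_zero]
  rw [basicHypergeometric, tsum_eq_single 0]
  · simp [h0]
  · intro k hk
    have : qShiftedFactorial q 1 k = 0 :=
      Finset.prod_eq_zero (Finset.mem_range.mpr (Nat.pos_of_ne_zero hk)) (by simp)
    simp [qShiftedFactorials, this]

theorem multiSum_eq {q a b c d : ℂ} (ha : a ≠ 0) {r : ℕ} (e f g : Fin r → ℂ) (n : Fin r → ℕ) :
    ∑ k ∈ Fintype.piFinset (fun i => Finset.range (n i + 1)),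
        (∏ i : Fin r, ∏ j ∈ Finset.Ioi i,
          (q ^ k i - q ^ k j) * (1 - a * q ^ (k i + k j))) *
        ∏ i : Fin r,
          (1 - a * q ^ (2 * k i)) *
            qShiftedFactorials q
              [a, b, c, d, e i, f i, g i, q ^ (-(n i : ℤ))] (k i) /
          ((1 - a) *
            qShiftedFactorials q
              [q, a * q / b, a * q / c, a * q / d, a * q / e i, a * q / f i, a * q / g i,
                a * q ^ (1 + n i)] (k i)) * q ^ k i = multiSum q a b c d e f g n := by
  simp only [baileyTerm_eq ha]
  rfl

theorem qShiftedFactorials_prefactor (q a lam e f : ℂ) (n : ℕ) :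
    qShiftedFactorials q [a * q, lam * q / e, lam * q / f, a * q / (e * f)] n /
      qShiftedFactorials q [lam * q, a * q / e, a * q / f, lam * q / (e * f)] n =
      baileyFactor q a lam e f n := by
  simp [qShiftedFactorials, baileyFactor, mul_assoc]

theorem qShiftedFactorials_ne_zero_iff {q : ℂ} {l : List ℂ} {n : ℕ} :
    qShiftedFactorials q l n ≠ 0 ↔ ∀ x ∈ l, qShiftedFactorial q x n ≠ 0 := by
  simp [qShiftedFactorials, List.prod_eq_zero_iff]

theorem mul_q_div_mul_div {a lam : ℂ} (ha : a ≠ 0) (hl : lam ≠ 0) (q y : ℂ) :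
    lam * q / (lam * y / a) = a * q / y := by
  by_cases hy : y = 0
  · simp [hy]
  · field_simp

theorem corollary5p1 (q : ℂ) (hq0 : q ≠ 0) (hq1 : ‖q‖ < 1) :
    -- the multivariable transformation
    (∀ (r : ℕ) (_ : 1 ≤ r) (a b c d lam : ℂ) (e f g : Fin r → ℂ) (n : Fin r → ℕ)
      (_ : a ≠ 0)
      (_ : ∀ i, a ^ 3 * q ^ ((3 : ℤ) - (r : ℤ) + (n i : ℤ)) = b * c * d * e i * f i * g i)
      (_ : lam = a ^ 2 * q ^ ((2 : ℤ) - (r : ℤ)) / (b * c * d))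
      -- no denominator vanishes
      (_ : a ≠ 1) (_ : lam ≠ 1)
      (_ : ∀ i, qShiftedFactorials q
        [a * q / b, a * q / c, a * q / d, a * q / e i, a * q / f i, a * q / g i,
          a * q ^ (1 + n i)] (n i) ≠ 0)
      (_ : ∀ i, qShiftedFactorials q
        [lam * q / e i, lam * q / f i, lam * q / g i, lam * q ^ (1 + n i),
          lam * q, lam * q / (e i * f i)] (n i) ≠ 0)
      (_ : qShiftedFactorials q [b * lam / a, c * lam / a, d * lam / a] (r - 1) ≠ 0),
      ∑ k ∈ Fintype.piFinset (fun i => Finset.range (n i + 1)),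
        (∏ i : Fin r, ∏ j ∈ Finset.Ioi i,
          (q ^ k i - q ^ k j) * (1 - a * q ^ (k i + k j))) *
        ∏ i : Fin r,
          (1 - a * q ^ (2 * k i)) *
            qShiftedFactorials q
              [a, b, c, d, e i, f i, g i, q ^ (-(n i : ℤ))] (k i) /
          ((1 - a) *
            qShiftedFactorials q
              [q, a * q / b, a * q / c, a * q / d, a * q / e i, a * q / f i, a * q / g i,
                a * q ^ (1 + n i)] (k i)) * q ^ k i
      = (lam / a) ^ (r.choose 2) *
        (∏ i ∈ Finset.Icc 1 (r - 1),
          qShiftedFactorials q [b, c, d] i /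
            qShiftedFactorials q [b * lam / a, c * lam / a, d * lam / a] i) *
        (∏ i : Fin r,
          qShiftedFactorials q
              [a * q, lam * q / e i, lam * q / f i, a * q / (e i * f i)] (n i) /
            qShiftedFactorials q
              [lam * q, a * q / e i, a * q / f i, lam * q / (e i * f i)] (n i)) *
        ∑ k ∈ Fintype.piFinset (fun i => Finset.range (n i + 1)),
          (∏ i : Fin r, ∏ j ∈ Finset.Ioi i,
            (q ^ k i - q ^ k j) * (1 - lam * q ^ (k i + k j))) *
          ∏ i : Fin r,
            (1 - lam * q ^ (2 * k i)) *
              qShiftedFactorials q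
                [lam, lam * b / a, lam * c / a, lam * d / a, e i, f i, g i,
                  q ^ (-(n i : ℤ))] (k i) /
            ((1 - lam) *
              qShiftedFactorials q
                [q, a * q / b, a * q / c, a * q / d, lam * q / e i, lam * q / f i,
                  lam * q / g i, lam * q ^ (1 + n i)] (k i)) * q ^ k i) ∧
    -- the case `r = 1`, written with one-variable series;
    -- `s` and `t` are square roots of `a` and `lam`
    (∀ (a b c d e f g lam s t : ℂ) (n : ℕ)
      (_ : a ≠ 0)
      (_ : a ^ 3 * q ^ (2 + n) = b * c * d * e * f * g)
      (_ : lam = a ^ 2 * q / (b * c * d))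
      (_ : s ^ 2 = a) (_ : t ^ 2 = lam)
      -- no denominator vanishes
      (_ : qShiftedFactorials q
        [s, -s, a * q / b, a * q / c, a * q / d, a * q / e, a * q / f, a * q / g,
          a * q ^ (1 + n)] n ≠ 0)
      (_ : qShiftedFactorials q
        [t, -t, lam * q / e, lam * q / f, lam * q / g, lam * q ^ (1 + n),
          lam * q, lam * q / (e * f)] n ≠ 0),
      basicHypergeometric
        [a, q * s, -(q * s), b, c, d, e, f, g, q ^ (-(n : ℤ))]
        [s, -s, a * q / b, a * q / c, a * q / d, a * q / e, a * q / f, a * q / g,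
          a * q ^ (1 + n)] q q
      = qShiftedFactorials q [a * q, a * q / (e * f), lam * q / e, lam * q / f] n /
          qShiftedFactorials q [a * q / e, a * q / f, lam * q / (e * f), lam * q] n *
        basicHypergeometric
          [lam, q * t, -(q * t), lam * b / a, lam * c / a, lam * d / a, e, f, g,
            q ^ (-(n : ℤ))]
          [t, -t, a * q / b, a * q / c, a * q / d, lam * q / e, lam * q / f, lam * q / g,
            lam * q ^ (1 + n)] q q) := by
  constructor
  · intro r hr a b c d lam e f g n ha hbal hlam ha1 hl1 hz hy hx
    have hne : ∀ i, b ≠ 0 ∧ c ≠ 0 ∧ d ≠ 0 ∧ e i ≠ 0 ∧ f i ≠ 0 ∧ g i ≠ 0 := by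
      intro i
      have h : b * c * d * e i * f i * g i ≠ 0 := by
        rw [← hbal i]
        exact mul_ne_zero (pow_ne_zero _ ha) (zpow_ne_zero _ hq0)
      simp only [mul_ne_zero_iff] at h
      tauto
    -- Nonvanishing of `b`, `c`, `d` comes from the balancing condition at some index, which exists
    -- because `r ≥ 1`.
    obtain ⟨hb, hc, hd, -⟩ := hne ⟨0, hr⟩
    have hbcd : b * c * d ≠ 0 := mul_ne_zero (mul_ne_zero hb hc) hd
    have hl : lam ≠ 0 := by
      rw [hlam]
      exact div_ne_zero (mul_ne_zero (pow_ne_zero _ ha) (zpow_ne_zero _ hq0)) hbcd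
    have hlam0 : lam * (b * c * d) = a ^ 2 * q ^ ((2 : ℤ) - r) := by
      rw [hlam, div_mul_cancel₀ _ hbcd]
    have hlam' : lam * (b * c * d) * q ^ r = a ^ 2 * q ^ 2 := by
      rw [hlam0, mul_assoc, ← zpow_natCast q r, ← zpow_add₀ hq0, sub_add_cancel]
      norm_cast
    have hbal' : ∀ i, e i * f i * g i = a * lam * q ^ (n i + 1) := by
      intro i
      apply mul_left_cancel₀ hbcd
      have h1 : q ^ ((3 : ℤ) - r + n i) = q ^ ((2 : ℤ) - r) * q ^ (n i + 1) := by
        rw [← zpow_natCast q (n i + 1), ← zpow_add₀ hq0]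
        congr 1
        push_cast
        ring
      have h2 := hbal i
      rw [h1] at h2
      linear_combination -h2 - a * q ^ (n i + 1) * hlam0
    simp only [qShiftedFactorials_ne_zero_iff, List.mem_cons, List.not_mem_nil, or_false,
      forall_eq_or_imp, forall_eq] at hz hy hx
    rw [multiSum_eq ha]
    have hR := multiSum_eq (q := q) (b := lam * b / a) (c := lam * c / a) (d := lam * d / a) hl
      e f g n
    simp only [mul_q_div_mul_div ha hl] at hR
    rw [hR, multiSum_transformation hq0 hq1 ha hb hc hd hl (fun i => (hne i).2.2.2.1)
      (fun i => (hne i).2.2.2.2.1) (fun i => (hne i).2.2.2.2.2) hlam' hbal' ha1 hl1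
      (fun i => (hz i).1) (fun i => (hz i).2.1) (fun i => (hz i).2.2.1)
      (fun i => (hz i).2.2.2.1) (fun i => (hz i).2.2.2.2.1) (fun i => (hz i).2.2.2.2.2.1)
      (fun i => (hz i).2.2.2.2.2.2) (fun i => (hy i).1) (fun i => (hy i).2.1)
      (fun i => (hy i).2.2.1) (fun i => (hy i).2.2.2.1) (fun i => (hy i).2.2.2.2.1)
      (fun i => (hy i).2.2.2.2.2) hx.1 hx.2.1 hx.2.2]
    simp only [qShiftedFactorials_prefactor]
    congr 3
    -- The determinant constants run over `0 ≤ i < r`; the trivial factor `i = 0` is dropped to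
    -- match `1 ≤ i ≤ r - 1`.
    obtain ⟨m, rfl⟩ : ∃ m, r = m + 1 := ⟨r - 1, by lia⟩
    rw [Nat.add_sub_cancel, ← Finset.prod_mul_distrib, ← Finset.prod_mul_distrib,
      ← Finset.prod_mul_distrib, ← Finset.prod_mul_distrib, ← Finset.prod_div_distrib,
      Finset.prod_range_succ', ← Finset.Ico_add_one_right_eq_Icc, Finset.prod_Ico_eq_prod_range,
      Nat.add_sub_cancel]
    simp only [qShiftedFactorial_zero, mul_one, div_one, add_comm 1, qShiftedFactorials,
      List.map_cons, List.map_nil, List.prod_cons, List.prod_nil, mul_assoc]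
  · intro a b c d e f g lam s t n ha hbal hlam hs ht hz hy
    have hne : b * c * d * e * f * g ≠ 0 := by
      rw [← hbal]
      exact mul_ne_zero (pow_ne_zero _ ha) (pow_ne_zero _ hq0)
    simp only [mul_ne_zero_iff] at hne
    obtain ⟨⟨⟨⟨⟨hb, hc⟩, hd⟩, he⟩, hf⟩, hg⟩ := hne
    have hbcd : b * c * d ≠ 0 := mul_ne_zero (mul_ne_zero hb hc) hd
    have hl : lam ≠ 0 := by
      rw [hlam]
      exact div_ne_zero (mul_ne_zero (pow_ne_zero _ ha) hq0) hbcd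
    have hlam' : lam * (b * c * d) = a ^ 2 * q := by rw [hlam, div_mul_cancel₀ _ hbcd]
    have hbal' : e * f * g = a * lam * q ^ (n + 1) := by
      apply mul_left_cancel₀ hbcd
      linear_combination -hbal - a * q ^ (n + 1) * hlam'
    -- For `n = 0` the hypotheses on `s` and `t` are empty and `a = 1` or `λ = 1` is possible, but
    -- both series are `1`. For `n > 0` they give `s, t ≠ ±1`, hence `a ≠ 1` and `λ ≠ 1`.
    rcases Nat.eq_zero_or_pos n with rfl | hn
    · have h1 := basicHypergeometric_of_zero_pow q q
        [a, q * s, -(q * s), b, c, d, e, f, g]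
        [s, -s, a * q / b, a * q / c, a * q / d, a * q / e, a * q / f, a * q / g,
          a * q ^ (1 + 0)]
      have h2 := basicHypergeometric_of_zero_pow q q
        [lam, q * t, -(q * t), lam * b / a, lam * c / a, lam * d / a, e, f, g]
        [t, -t, a * q / b, a * q / c, a * q / d, lam * q / e, lam * q / f, lam * q / g,
            lam * q ^ (1 + 0)]
      simp only [List.cons_append, List.nil_append] at h1 h2
      rw [h1, h2]
      simp [qShiftedFactorials, qShiftedFactorial_zero]
    simp only [qShiftedFactorials_ne_zero_iff, List.mem_cons, List.not_mem_nil, or_false,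
      forall_eq_or_imp, forall_eq] at hz hy
    obtain ⟨z1, z2, zb, zc, zd, ze, zf, zg, zn⟩ := hz
    obtain ⟨y1, y2, ye, yf, yg, yn, yl, yef⟩ := hy
    have ne_one : ∀ {x y : ℂ}, x ^ 2 = y → qShiftedFactorial q x n ≠ 0 →
        qShiftedFactorial q (-x) n ≠ 0 → y ≠ 1 := by
      intro x y hxy h1 h2 hy1
      have h3 := qShiftedFactorial_ne_zero_iff.mp h1 0 hn
      have h4 := qShiftedFactorial_ne_zero_iff.mp h2 0 hn
      rw [pow_zero, mul_one] at h3 h4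
      exact mul_ne_zero h3 h4 (by linear_combination -hxy - hy1)
    have ha1 := ne_one hs z1 z2
    have hl1 := ne_one ht y1 y2
    have hR := basicHypergeometric_eq_sum_baileyTerm (b := lam * b / a) (c := lam * c / a)
      (d := lam * d / a) (e := e) (f := f) (g := g) hq0 hl hl1 ht y1 y2
    simp only [mul_q_div_mul_div ha hl] at hR
    rw [hR, basicHypergeometric_eq_sum_baileyTerm hq0 ha ha1 hs z1 z2,
      bailey_transformation hq0 hq1 ha hb hc hd he hf hg hl hlam' hbal' ha1 hl1 zb zc zd ze zf zg
        zn ye yf yg yn yl yef]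
    congr 1
    simp only [qShiftedFactorials, List.map_cons, List.map_nil, List.prod_cons, List.prod_nil,
      baileyFactor]
    ring
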